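/- **Setting.** Let $Y_{jt}=\mu_j+u_{jt}$ ($j=1,2$), where the error series $\{u_{1t}\}$ and $\{u_{2t}\}$ are independent of each other. For sample sizes $T_j$ let $\bar Y_j=T_j^{-1}\sum_{t=1}^{T_j}Y_{jt}$, $\hat u_{jt}=Y_{jt}-\bar Y_j$, and, with $\phi_\ell(x)=\sqrt2\cos(2\pi\ell x)$ for odd $\ell$ and $\phi_\ell(x)=\sqrt2\sin(2\pi\ell x)$ for even $\ell$, let $$\hat\Omega_j=\frac1{K_j}\sum_{\ell=1}^{K_j}\Big(\frac1{\sqrt{T_j}}\sum_{t=1}^{T_j}\phi_\ell\big(t/T_j\big)\,\hat u_{jt}\Big)^2,\qquad t_{1,\mathrm{HAR}}=\frac{\bar Y_1-\bar Y_2}{\sqrt{\hat\Omega_1/T_1+\hat\Omega_2/T_2}} .$$ Let $\Omega_j=\lim_{T\to\infty}\mathrm{Var}\big(\sqrt T\,(\bar Y_j-\mu_j)\big)$, the mean being over $T$ observations, denote the long-run variances, with $\Omega_j>0$ (they may be unequal). **Assumptions.** (a) The functional central limit theorem holds for $u_t=(u_{1t},u_{2t})'$: in the Skorokhod space $D([0,1],\mathbb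 R^2)$, as $T\to\infty$, $T^{-1/2}\sum_{t=1}^{\lfloor rT\rfloor}u_t\to^d \mathrm{diag}(\sqrt{\Omega_1},\sqrt{\Omega_2})\,W_2(r)$, where $W_2$ is a two-dimensional standard Brownian motion. (b) For $j=1,2$, $\{u_{jt}\}_{t\in\mathbb Z}$ is mean zero and fourth-order stationary (finite fourth moments, joint moments up to order four invariant under time shifts), with $\sum_{h\in\mathbb Z}|h|^3|\gamma_j(h)|<\infty$ and $\sum_{h_1,h_2,h_3\in\mathbb Z}|\kappa_j(0,h_1,h_2,h_3)|<\infty$. Here $\gamma_j(h)=E(u_{jt}u_{j,t+h})$, and $\kappa_j(0,h_1,h_2,h_3)$ is the fourth-order cumulant of $(u_{jt},u_{j,t+h_1},u_{j,t+h_2},u_{j,t+h_3})$, that is, its fourth joint central moment minus that of a Gaussian vector with the same mean and covariance matrix. **Theorem.** Let $T_j\to\infty$ and $K_j\to\infty$ with $K_j/T_j\to0$ for $j=1,2$. Then $\hat\Omega_j\to^P\Omega_j$ for $j=1,2$, and under $H_0:\mu_1=\mu_2$, $$t_{1,\mathrm{HAR}}\to^d N(0,1).$$ -/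

import Mathlib

open MeasureTheory ProbabilityTheory Filter
open scoped Topology NNReal ENNReal unitInterval

noncomputable section

namespace SeriesHAR

/-! ### The series HAR statistic -/

/-- The trigonometric orthonormal system on `[0,1]`, for `ℓ = 1, 2, …`:
`√2 cos (2πℓx)` for odd `ℓ` and `√2 sin (2πℓx)` for even `ℓ`. -/
def basisFun (ℓ : ℕ) (x : ℝ) : ℝ :=
  if Odd ℓ then √2 * Real.cos (2 * Real.pi * ℓ * x) else √2 * Real.sin (2 * Real.pi * ℓ * x)

/-- The sample mean of `Y 1, …, Y T`. -/
def sampleMean {Ω : Type*} (Y : ℤ → Ω → ℝ) (T : ℕ) (ω : Ω) : ℝ :=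
  (1 / (T : ℝ)) * ∑ t ∈ Finset.Icc 1 T, Y (t : ℤ) ω

/-- The residual `û t = Y t - Ȳ`. -/
def residual {Ω : Type*} (Y : ℤ → Ω → ℝ) (T : ℕ) (t : ℕ) (ω : Ω) : ℝ :=
  Y (t : ℤ) ω - sampleMean Y T ω

/-- The projection coefficient `ẑ_ℓ = T^{-1/2} ∑_{t=1}^T φ_ℓ(t/T) û t`. -/
def projCoef {Ω : Type*} (Y : ℤ → Ω → ℝ) (T ℓ : ℕ) (ω : Ω) : ℝ :=
  (1 / √(T : ℝ)) * ∑ t ∈ Finset.Icc 1 T, basisFun ℓ ((t : ℝ) / (T : ℝ)) * residual Y T t ω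

/-- The series estimator `K^{-1} ∑_{ℓ=1}^K ẑ_ℓ²` of the long-run variance. -/
def lrvEstimator {Ω : Type*} (Y : ℤ → Ω → ℝ) (T K : ℕ) (ω : Ω) : ℝ :=
  (1 / (K : ℝ)) * ∑ ℓ ∈ Finset.Icc 1 K, projCoef Y T ℓ ω ^ 2

/-- The Welch-type series HAR two-sample statistic. The two samples are indexed by `0` and `1`. -/
def tStatHAR {Ω : Type*} (Y : Fin 2 → ℤ → Ω → ℝ) (T K : Fin 2 → ℕ) (ω : Ω) : ℝ :=
  (sampleMean (Y 0) (T 0) ω - sampleMean (Y 1) (T 1) ω) /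
    √(lrvEstimator (Y 0) (T 0) (K 0) ω / (T 0 : ℝ) + lrvEstimator (Y 1) (T 1) (K 1) ω / (T 1 : ℝ))

/-- `v` is the long-run variance of `Y`, a series with mean `m`: the limit of
`Var (√T (Ȳ_T - m))` as `T → ∞`. -/
def IsLongRunVariance {Ω : Type*} [MeasurableSpace Ω] (P : Measure Ω) (Y : ℤ → Ω → ℝ)
    (m v : ℝ) : Prop :=
  Tendsto (fun T : ℕ => Var[fun ω => √(T : ℝ) * (sampleMean Y T ω - m); P]) atTop (𝓝 v)

/-! ### The functional central limit theorem -/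

/-- Right-continuous paths with left limits on `[0,1]`, with values in `ℝ²`. -/
def IsCadlag (x : I → Fin 2 → ℝ) : Prop :=
  ∀ t : I, ContinuousWithinAt x (Set.Ici t) t ∧ ∃ l, Tendsto x (𝓝[<] t) (𝓝 l)

/-- Continuity on the Skorokhod space `D([0,1], ℝ²)` (the `J₁` topology) of a functional: `y` is
close to `x` if, for some increasing bijection `τ` of `[0,1]`, both `τ` is uniformly close to the
identity and `y ∘ τ` is uniformly close to `x`. Values of `F` off the càdlàg paths are irrelevant. -/
def SkorokhodContinuous (F : (I → Fin 2 → ℝ) → ℝ) : Prop :=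
  ∀ x, IsCadlag x → ∀ ε > (0 : ℝ), ∃ δ > (0 : ℝ), ∀ y, IsCadlag y →
    (∃ τ : I ≃o I, (∀ t, |(τ t : ℝ) - (t : ℝ)| < δ) ∧ (∀ t, ‖y (τ t) - x t‖ < δ)) →
    |F y - F x| < ε

/-- Convergence in distribution, in the Skorokhod space `D([0,1], ℝ²)`, of a sequence of random
càdlàg paths `X n` to a random path `Z` that is almost surely càdlàg. -/
def TendstoInSkorokhod {Ω Ω' : Type*} [MeasurableSpace Ω] [MeasurableSpace Ω']
    (P : Measure Ω) (X : ℕ → Ω → I → Fin 2 → ℝ) (P' : Measure Ω') (Z : Ω' → I → Fin 2 → ℝ) : Prop :=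
  ∀ F : (I → Fin 2 → ℝ) → ℝ, (∃ C, ∀ x, |F x| ≤ C) → SkorokhodContinuous F →
    Tendsto (fun n => ∫ ω, F (X n ω) ∂P) atTop (𝓝 (∫ ω, F (Z ω) ∂P'))

/-- The normalized partial-sum path `r ↦ T^{-1/2} ∑_{t=1}^{⌊rT⌋} u_t`. -/
def partialSumPath {Ω : Type*} (u : Fin 2 → ℤ → Ω → ℝ) (T : ℕ) (ω : Ω) : I → Fin 2 → ℝ :=
  fun r j => (1 / √(T : ℝ)) * ∑ t ∈ Finset.Icc 1 ⌊(r : ℝ) * (T : ℝ)⌋₊, u j (t : ℤ) ω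

/-- `W` is a two-dimensional standard Brownian motion: its components are independent standard
Brownian motions. -/
structure IsBrownianMotion2 {Ω' : Type*} [MeasurableSpace Ω'] (P' : Measure Ω')
    (W : Fin 2 → ℝ≥0 → Ω' → ℝ) : Prop where
  brownian : ∀ j, IsBrownianReal (W j) P'
  indep : IndepFun (fun ω s => W 0 s ω) (fun ω s => W 1 s ω) P'

/-- The path `r ↦ diag(√v₀, √v₁) W(r)` on `[0,1]`. -/
def scaledBrownianPath {Ω' : Type*} (v : Fin 2 → ℝ) (W : Fin 2 → ℝ≥0 → Ω' → ℝ) (ω : Ω') :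
    I → Fin 2 → ℝ :=
  fun r j => √(v j) * W j (unitInterval.toNNReal r) ω

/-! ### Fourth-order stationarity and cumulants -/

/-- Fourth-order stationarity: finite fourth moments, and all joint moments up to order four are
invariant under time shifts. -/
structure IsFourthOrderStationary {Ω : Type*} [MeasurableSpace Ω] (P : Measure Ω)
    (u : ℤ → Ω → ℝ) : Prop where
  measurable : ∀ t, Measurable (u t)
  memLp_four : ∀ t, MemLp (u t) 4 P
  moment_shift : ∀ k : ℕ, k ≤ 4 → ∀ (t : Fin k → ℤ) (h : ℤ),
    ∫ ω, ∏ i, u (t i + h) ω ∂P = ∫ ω, ∏ i, u (t i) ω ∂P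

/-- The autocovariance `γ(h) = E (u_t u_{t+h})` of a mean-zero stationary series, taken at
`t = 0`. -/
def autocov {Ω : Type*} [MeasurableSpace Ω] (P : Measure Ω) (u : ℤ → Ω → ℝ) (h : ℤ) : ℝ :=
  ∫ ω, u 0 ω * u h ω ∂P

/-- The fourth-order cumulant of `(u_{t₀}, u_{t₁}, u_{t₂}, u_{t₃})`: the fourth joint central moment
minus that of the Gaussian vector with the same mean and the same covariance matrix. -/
def fourthCumulant {Ω : Type*} [MeasurableSpace Ω] (P : Measure Ω) (u : ℤ → Ω → ℝ)
    (t : Fin 4 → ℤ) : ℝ :=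
  ∫ ω, ∏ i, (u (t i) ω - ∫ ω', u (t i) ω' ∂P) ∂P -
    ∫ x : EuclideanSpace ℝ (Fin 4), ∏ i, (x i - ∫ ω', u (t i) ω' ∂P)
      ∂(multivariateGaussian (WithLp.toLp 2 fun i => ∫ ω', u (t i) ω' ∂P)
        (Matrix.of fun i k => cov[u (t i), u (t k); P]))

/-- Mean-zero fourth-order stationary errors with `∑_h |h|³ |γ(h)| < ∞` and
`∑_{h₁,h₂,h₃} |κ(0,h₁,h₂,h₃)| < ∞`, the sums being over all integers. -/
structure ErrorCondition {Ω : Type*} [MeasurableSpace Ω] (P : Measure Ω)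
    (u : ℤ → Ω → ℝ) : Prop where
  stationary : IsFourthOrderStationary P u
  mean_zero : ∀ t, ∫ ω, u t ω ∂P = 0
  summable_autocov : Summable fun h : ℤ => |(h : ℝ)| ^ 3 * |autocov P u h|
  summable_cumulant : Summable fun h : ℤ × ℤ × ℤ =>
    |fourthCumulant P u ![0, h.1, h.2.1, h.2.2]|

end SeriesHAR

end

namespace SeriesHAR

/-! ### Toeplitz sums -/

/-! Let `S` be the sum of the autocovariances. Summability of `|h| |γ(h)|` identifies it with the
long-run variance.

Consistency is a mean-square computation. For `0 < ℓ < T` the basis functions sum to zero on the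
grid, so centering by the sample mean leaves each projection coefficient a weighted sum of errors.
The weights vary slowly, so `abs_toeplitz_sub_le` replaces the autocovariance form by `S` times a
diagonal form. Discrete orthonormality then gives `E ẑ_ℓ ẑ_m = S δ_ℓm + O(K/T + 1/T)`. Fourth cross
moments agree with the Gaussian ones up to `O(1/T)`, by Isserlis' formula and summable cumulants.
Averaging `K` nearly uncorrelated squares has mean-square error `O(1/K + (K/T)² + 1/T)`, as in
`integral_average_sq_sub_sq_le`.

For the statistic, the functional limit theorem is needed only at time one, and only for each series
separately; independence multiplies the characteristic functions. The ratio of sample sizes need not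
converge, so the weights on the two normalized sums need not either. They are bounded and satisfy
`v₀ a² + v₁ b² = 1`, hence every cluster point gives the same normal limit. Slutsky's theorem
replaces the true variances by the estimates. -/

lemma sum_Icc_natCast {M : Type*} [AddCommMonoid M] (T : ℕ) (f : ℤ → M) :
    ∑ t ∈ Finset.Icc 1 T, f (t : ℤ) = ∑ t ∈ Finset.Icc (1 : ℤ) T, f t := by
  refine Finset.sum_bij (fun t _ => (t : ℤ)) (fun t ht => ?_) (fun a _ b _ hab => ?_)
    (fun t ht => ?_) (fun _ _ => rfl)
  · simp only [Finset.mem_Icc] at ht ⊢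
    omega
  · exact_mod_cast hab
  · simp only [Finset.mem_Icc] at ht
    exact ⟨t.toNat, by simp only [Finset.mem_Icc]; omega, by omega⟩

lemma card_filter_add_notMem_Icc_le (T : ℕ) (h : ℤ) :
    (((Finset.Icc (1 : ℤ) T).filter fun t => t + h ∉ Finset.Icc (1 : ℤ) T).card : ℝ) ≤ |(h : ℝ)| := by
  have key : ((((Finset.Icc (1 : ℤ) T).filter
      fun t => t + h ∉ Finset.Icc (1 : ℤ) T).card : ℕ) : ℤ) ≤ |h| := by
    rcases le_or_gt 0 h with h0 | h0
    · have hsub : (Finset.Icc (1 : ℤ) T).filter (fun t => t + h ∉ Finset.Icc (1 : ℤ) T) ⊆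
          Finset.Ioc ((T : ℤ) - h) T := by
        intro t ht
        simp only [Finset.mem_filter, Finset.mem_Icc, Finset.mem_Ioc] at ht ⊢
        omega
      have := Finset.card_le_card hsub
      rw [Int.card_Ioc] at this
      rw [abs_of_nonneg h0]
      omega
    · have hsub : (Finset.Icc (1 : ℤ) T).filter (fun t => t + h ∉ Finset.Icc (1 : ℤ) T) ⊆
          Finset.Ico 1 (1 - h) := by
        intro t ht
        simp only [Finset.mem_filter, Finset.mem_Icc, Finset.mem_Ico] at ht ⊢
        omega
      have := Finset.card_le_card hsub
      rw [Int.card_Ico] at this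
      rw [abs_of_neg h0]
      omega
  exact_mod_cast key

/-- Extending `v` by zero off `J` turns a finite sum into a series over all lags, which can be
compared termwise with `∑ γ(h)`. -/
lemma hasSum_shift_mul (J : Finset ℤ) (t : ℤ) (v γ : ℤ → ℝ) :
    HasSum (fun h => (if t + h ∈ J then v (t + h) else 0) * γ h) (∑ s ∈ J, v s * γ (s - t)) := by
  have h1 : HasSum (fun s => (if s ∈ J then v s else 0) * γ (s - t))
      (∑ s ∈ J, (if s ∈ J then v s else 0) * γ (s - t)) :=
    hasSum_sum_of_ne_finset_zero fun s hs => by simp [hs]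
  have h2 : ∑ s ∈ J, (if s ∈ J then v s else 0) * γ (s - t) = ∑ s ∈ J, v s * γ (s - t) :=
    Finset.sum_congr rfl fun s hs => by simp [hs]
  rw [h2, ← (Equiv.addLeft t).hasSum_iff] at h1
  simpa [Function.comp_def] using h1

/-- A Toeplitz form in slowly varying weights is close to its diagonal form. -/
lemma abs_toeplitz_sub_le {γ : ℤ → ℝ} (hγ : Summable fun h => |γ h|)
    (hγ1 : Summable fun h : ℤ => |(h : ℝ)| * |γ h|) {w v : ℤ → ℝ} {B L : ℝ} (hB : 0 ≤ B)
    (hL : 0 ≤ L) (hw : ∀ t, |w t| ≤ B) (hv : ∀ t, |v t| ≤ B)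
    (hvL : ∀ t h : ℤ, |v (t + h) - v t| ≤ L * |(h : ℝ)|) (T : ℕ) :
    |∑ t ∈ Finset.Icc (1 : ℤ) T, ∑ s ∈ Finset.Icc (1 : ℤ) T, w t * v s * γ (s - t) -
      (∑' h, γ h) * ∑ t ∈ Finset.Icc (1 : ℤ) T, w t * v t| ≤
      (T * (B * L) + B ^ 2) * ∑' h : ℤ, |(h : ℝ)| * |γ h| := by
  set J := Finset.Icc (1 : ℤ) T with hJ
  have hγs : Summable γ := hγ.of_abs
  -- The difference is reorganized by the lag `h = s - t`. At each lag, indices that stay in the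
  -- window cost the Lipschitz bound, and the at most `|h|` indices that leave it cost `B ^ 2` each.
  have hsum : HasSum (fun h => ∑ t ∈ J, w t * ((if t + h ∈ J then v (t + h) else 0) - v t) * γ h)
      (∑ t ∈ J, ∑ s ∈ J, w t * v s * γ (s - t) - (∑' h, γ h) * ∑ t ∈ J, w t * v t) := by
    rw [Finset.mul_sum, ← Finset.sum_sub_distrib]
    refine hasSum_sum fun t _ => ?_
    have := ((hasSum_shift_mul J t v γ).mul_left (w t)).sub
      (hγs.hasSum.mul_right (w t * v t))
    rw [Finset.mul_sum] at this
    simp_rw [mul_assoc] at this ⊢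
    refine this.congr_fun fun h => ?_
    ring
  rw [← hsum.tsum_eq]
  rw [← Real.norm_eq_abs]
  refine tsum_of_norm_bounded (hγ1.hasSum.mul_left _) fun h => ?_
  rw [Real.norm_eq_abs]
  have hbound : ∀ t ∈ J, |w t * ((if t + h ∈ J then v (t + h) else 0) - v t) * γ h| ≤
      (B * L * |(h : ℝ)| + (if t + h ∉ J then B ^ 2 else 0)) * |γ h| := by
    intro t _
    rw [abs_mul, abs_mul]
    refine mul_le_mul_of_nonneg_right ?_ (abs_nonneg _)
    by_cases h1 : t + h ∈ J
    · rw [if_pos h1, if_neg (not_not.2 h1), add_zero, mul_assoc]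
      exact mul_le_mul (hw t) (hvL t h) (abs_nonneg _) hB
    · rw [if_neg h1, if_pos h1, zero_sub, abs_neg]
      have := mul_le_mul (hw t) (hv t) (abs_nonneg _) hB
      have : 0 ≤ B * L * |(h : ℝ)| := by positivity
      nlinarith
  calc |∑ t ∈ J, w t * ((if t + h ∈ J then v (t + h) else 0) - v t) * γ h|
      ≤ ∑ t ∈ J, (B * L * |(h : ℝ)| + (if t + h ∉ J then B ^ 2 else 0)) * |γ h| :=
        (Finset.abs_sum_le_sum_abs _ _).trans (Finset.sum_le_sum hbound)
    _ = (T * (B * L * |(h : ℝ)|) + (J.filter fun t => t + h ∉ J).card * B ^ 2) * |γ h| := by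
        rw [← Finset.sum_mul, Finset.sum_add_distrib, ← Finset.sum_filter]
        simp [hJ]
    _ ≤ (T * (B * L * |(h : ℝ)|) + |(h : ℝ)| * B ^ 2) * |γ h| := by
        gcongr
        exact card_filter_add_notMem_Icc_le T h
    _ = (T * (B * L) + B ^ 2) * (|(h : ℝ)| * |γ h|) := by ring

/-- For fixed `a` the lag map on `(b, c, d)` is injective, so the triple sum is at most the full
series. Only the choice of `a` is free, which gives order `T`. -/
lemma abs_sum_four_le {κ : ℤ × ℤ × ℤ → ℝ} (hκ : Summable fun h => |κ h|) {w v : ℤ → ℝ} {B : ℝ}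
    (hw : ∀ t, |w t| ≤ B) (hv : ∀ t, |v t| ≤ B) (T : ℕ) :
    |∑ a ∈ Finset.Icc (1 : ℤ) T, ∑ b ∈ Finset.Icc (1 : ℤ) T, ∑ c ∈ Finset.Icc (1 : ℤ) T,
      ∑ d ∈ Finset.Icc (1 : ℤ) T, w a * w b * (v c * v d) * κ (b - a, c - a, d - a)| ≤
      T * (B ^ 4 * ∑' h, |κ h|) := by
  set J := Finset.Icc (1 : ℤ) T with hJ
  have hB : 0 ≤ B := (abs_nonneg _).trans (hw 0)
  have hfix : ∀ a ∈ J, |∑ b ∈ J, ∑ c ∈ J, ∑ d ∈ J,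
      w a * w b * (v c * v d) * κ (b - a, c - a, d - a)| ≤ B ^ 4 * ∑' h, |κ h| := by
    intro a _
    let e : ℤ × ℤ × ℤ ↪ ℤ × ℤ × ℤ :=
      ⟨fun p => (p.1 - a, p.2.1 - a, p.2.2 - a), fun p q hpq => by
        simp only [Prod.mk.injEq, sub_left_inj] at hpq
        exact Prod.ext hpq.1 (Prod.ext hpq.2.1 hpq.2.2)⟩
    have h1 : ∑ b ∈ J, ∑ c ∈ J, ∑ d ∈ J, |κ (b - a, c - a, d - a)| ≤ ∑' h, |κ h| := by
      have := hκ.sum_le_tsum ((J ×ˢ J ×ˢ J).map e) (fun _ _ => abs_nonneg _)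
      rw [Finset.sum_map, Finset.sum_product] at this
      simp_rw [Finset.sum_product] at this
      exact this
    have h2 : |∑ b ∈ J, ∑ c ∈ J, ∑ d ∈ J, w a * w b * (v c * v d) * κ (b - a, c - a, d - a)| ≤
        ∑ b ∈ J, ∑ c ∈ J, ∑ d ∈ J, B ^ 4 * |κ (b - a, c - a, d - a)| := by
      refine (Finset.abs_sum_le_sum_abs _ _).trans (Finset.sum_le_sum fun b _ => ?_)
      refine (Finset.abs_sum_le_sum_abs _ _).trans (Finset.sum_le_sum fun c _ => ?_)
      refine (Finset.abs_sum_le_sum_abs _ _).trans (Finset.sum_le_sum fun d _ => ?_)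
      rw [abs_mul, abs_mul, abs_mul, abs_mul]
      refine mul_le_mul_of_nonneg_right ?_ (abs_nonneg _)
      calc |w a| * |w b| * (|v c| * |v d|) ≤ B * B * (B * B) := by
            gcongr <;> first | exact hw _ | exact hv _
        _ = B ^ 4 := by ring
    refine h2.trans ?_
    simp_rw [← Finset.mul_sum]
    exact mul_le_mul_of_nonneg_left h1 (by positivity)
  calc _ ≤ ∑ a ∈ J, B ^ 4 * ∑' h, |κ h| :=
        (Finset.abs_sum_le_sum_abs _ _).trans (Finset.sum_le_sum hfix)
    _ = _ := by simp [hJ]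

/-! ### The trigonometric system on the grid -/

lemma abs_basisFun_le (ℓ : ℕ) (x : ℝ) : |basisFun ℓ x| ≤ √2 := by
  unfold basisFun
  split_ifs
  · rw [abs_mul, abs_of_nonneg (Real.sqrt_nonneg 2)]
    exact mul_le_of_le_one_right (Real.sqrt_nonneg 2) (Real.abs_cos_le_one _)
  · rw [abs_mul, abs_of_nonneg (Real.sqrt_nonneg 2)]
    exact mul_le_of_le_one_right (Real.sqrt_nonneg 2) (Real.abs_sin_le_one _)

lemma abs_basisFun_sub_le (ℓ : ℕ) (x y : ℝ) :
    |basisFun ℓ x - basisFun ℓ y| ≤ √2 * (2 * Real.pi * ℓ) * |x - y| := by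
  have hxy : |2 * Real.pi * ℓ * x - 2 * Real.pi * ℓ * y| = 2 * Real.pi * ℓ * |x - y| := by
    rw [← mul_sub, abs_mul, abs_of_nonneg (by positivity)]
  unfold basisFun
  split_ifs <;> rw [← mul_sub, abs_mul, abs_of_nonneg (Real.sqrt_nonneg 2), mul_assoc (√2), ← hxy]
  · exact mul_le_mul_of_nonneg_left (Real.abs_cos_sub_cos_le _ _) (Real.sqrt_nonneg 2)
  · exact mul_le_mul_of_nonneg_left (Real.abs_sin_sub_sin_le _ _) (Real.sqrt_nonneg 2)

/-- The terms are successive powers of a `T`-th root of unity, different from 1 because `T` does not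
divide `k`; the geometric sum vanishes. -/
lemma sum_exp_grid {T : ℕ} {k : ℤ} (hk : ¬ (T : ℤ) ∣ k) :
    ∑ t ∈ Finset.Icc (1 : ℤ) T,
      Complex.exp ((2 * Real.pi * k * (t / T) : ℝ) * Complex.I) = 0 := by
  rcases Nat.eq_zero_or_pos T with rfl | hT
  · simp
  have hT' : (T : ℂ) ≠ 0 := by exact_mod_cast hT.ne'
  set ζ : ℂ := Complex.exp (2 * Real.pi * Complex.I * (k / T)) with hζ
  have hterm : ∀ t : ℕ, Complex.exp ((2 * Real.pi * k * (((t : ℕ) : ℤ) / T) : ℝ) * Complex.I) =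
      ζ ^ t := by
    intro t
    rw [hζ, ← Complex.exp_nat_mul]
    congr 1
    push_cast
    ring
  have hζT : ζ ^ T = 1 := by
    rw [hζ, ← Complex.exp_nat_mul, Complex.exp_eq_one_iff]
    exact ⟨k, by field_simp⟩
  have hζ1 : ζ ≠ 1 := by
    rw [hζ, Ne, Complex.exp_eq_one_iff]
    rintro ⟨n, hn⟩
    apply hk
    refine ⟨n, ?_⟩
    have h2 : (2 * Real.pi * Complex.I : ℂ) ≠ 0 := Complex.two_pi_I_ne_zero
    rw [mul_comm] at hn
    have h3 := mul_right_cancel₀ h2 hn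
    rw [div_eq_iff hT'] at h3
    have h4 : k = n * T := by exact_mod_cast h3
    rw [h4, mul_comm]
  rw [← sum_Icc_natCast T fun t : ℤ =>
    Complex.exp ((2 * Real.pi * k * (t / T) : ℝ) * Complex.I)]
  rw [Finset.sum_congr rfl fun t _ => hterm t, ← Finset.Ico_add_one_right_eq_Icc,
    Finset.sum_Ico_eq_sum_range]
  simp_rw [pow_add, ← Finset.mul_sum]
  rw [Nat.add_sub_cancel, geom_sum_eq hζ1, hζT]
  simp

lemma sum_cos_grid {T : ℕ} {k : ℤ} (hk : ¬ (T : ℤ) ∣ k) :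
    ∑ t ∈ Finset.Icc (1 : ℤ) T, Real.cos (2 * Real.pi * k * (t / T)) = 0 := by
  have h := congrArg Complex.re (sum_exp_grid hk)
  rw [Complex.re_sum] at h
  simpa only [Complex.exp_ofReal_mul_I_re, Complex.zero_re] using h

lemma sum_sin_grid {T : ℕ} {k : ℤ} (hk : ¬ (T : ℤ) ∣ k) :
    ∑ t ∈ Finset.Icc (1 : ℤ) T, Real.sin (2 * Real.pi * k * (t / T)) = 0 := by
  have h := congrArg Complex.im (sum_exp_grid hk)
  rw [Complex.im_sum] at h
  simpa only [Complex.exp_ofReal_mul_I_im, Complex.zero_im] using h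

/-- This is what makes the projections insensitive to the unknown mean and to its estimate. -/
lemma sum_basisFun_grid {T ℓ : ℕ} (hℓ : 0 < ℓ) (hℓT : ℓ < T) :
    ∑ t ∈ Finset.Icc (1 : ℤ) T, basisFun ℓ ((t : ℝ) / T) = 0 := by
  have hk : ¬ (T : ℤ) ∣ ℓ := by
    rw [Int.natCast_dvd_natCast]
    exact Nat.not_dvd_of_pos_of_lt hℓ hℓT
  unfold basisFun
  split_ifs <;> rw [← Finset.mul_sum]
  · simpa using sum_cos_grid hk
  · simpa using sum_sin_grid hk

lemma basisFun_mul_basisFun (ℓ m : ℕ) (x : ℝ) :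
    basisFun ℓ x * basisFun m x =
      if Odd ℓ then
        if Odd m then Real.cos (2 * Real.pi * ((ℓ : ℤ) - m : ℤ) * x) +
          Real.cos (2 * Real.pi * ((ℓ : ℤ) + m : ℤ) * x)
        else Real.sin (2 * Real.pi * ((ℓ : ℤ) + m : ℤ) * x) -
          Real.sin (2 * Real.pi * ((ℓ : ℤ) - m : ℤ) * x)
      else
        if Odd m then Real.sin (2 * Real.pi * ((ℓ : ℤ) - m : ℤ) * x) +
          Real.sin (2 * Real.pi * ((ℓ : ℤ) + m : ℤ) * x)
        else Real.cos (2 * Real.pi * ((ℓ : ℤ) - m : ℤ) * x) -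
          Real.cos (2 * Real.pi * ((ℓ : ℤ) + m : ℤ) * x) := by
  have h2 : √2 * √2 = (2 : ℝ) := Real.mul_self_sqrt (by norm_num)
  have e1 : 2 * Real.pi * (((ℓ : ℤ) - m : ℤ) : ℝ) * x =
    2 * Real.pi * ℓ * x - 2 * Real.pi * m * x := by push_cast; ring
  have e2 : 2 * Real.pi * (((ℓ : ℤ) + m : ℤ) : ℝ) * x =
    2 * Real.pi * ℓ * x + 2 * Real.pi * m * x := by push_cast; ring
  rw [e1, e2, Real.cos_add, Real.cos_sub, Real.sin_add, Real.sin_sub]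
  unfold basisFun
  split_ifs
  · linear_combination (Real.cos (2 * Real.pi * ℓ * x) * Real.cos (2 * Real.pi * m * x)) * h2
  · linear_combination (Real.cos (2 * Real.pi * ℓ * x) * Real.sin (2 * Real.pi * m * x)) * h2
  · linear_combination (Real.sin (2 * Real.pi * ℓ * x) * Real.cos (2 * Real.pi * m * x)) * h2
  · linear_combination (Real.sin (2 * Real.pi * ℓ * x) * Real.sin (2 * Real.pi * m * x)) * h2

/-- Discrete orthonormality of the trigonometric system below the Nyquist frequency. -/
lemma sum_basisFun_mul_basisFun {T ℓ m : ℕ} (hℓ : 0 < ℓ) (hm : 0 < m) (hT : ℓ + m < T) :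
    ∑ t ∈ Finset.Icc (1 : ℤ) T, basisFun ℓ ((t : ℝ) / T) * basisFun m ((t : ℝ) / T) =
      if ℓ = m then (T : ℝ) else 0 := by
  -- Both frequencies `ℓ + m` and, for `ℓ ≠ m`, `ℓ - m` are nonzero and smaller than `T` in absolute
  -- value, so the grid sums at these frequencies vanish.
  have hp : ¬ (T : ℤ) ∣ (ℓ : ℤ) + m := by
    intro h
    have := Int.le_of_dvd (by omega) h
    omega
  simp_rw [basisFun_mul_basisFun]
  by_cases hlm : ℓ = m
  · subst hlm
    rw [if_pos rfl]
    split_ifs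
    · rw [Finset.sum_add_distrib, sum_cos_grid hp]
      simp
    · rw [Finset.sum_sub_distrib, sum_cos_grid hp]
      simp
  · have hd : ¬ (T : ℤ) ∣ (ℓ : ℤ) - m := by
      intro h
      have := Int.eq_zero_of_abs_lt_dvd h (by rw [abs_lt]; omega)
      omega
    rw [if_neg hlm]
    split_ifs <;> simp only [Finset.sum_add_distrib, Finset.sum_sub_distrib, sum_cos_grid hp,
      sum_cos_grid hd, sum_sin_grid hp, sum_sin_grid hd, add_zero, sub_zero]

/-! ### Fourth moments of Gaussian vectors -/

lemma integral_pow_four_gaussianReal (v : ℝ≥0) :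
    ∫ x, x ^ 4 ∂(gaussianReal 0 v) = 3 * (v : ℝ) ^ 2 := by
  have h0 : (0 : ℝ) ∈ interior (integrableExpSet id (gaussianReal 0 v)) := by
    rw [integrableExpSet_id_gaussianReal]
    simp
  have h := iteratedDeriv_mgf_zero h0 4
  -- Differentiating `p(t) exp(v t² / 2)` replaces `p` by `p' + p v t`, so four derivatives of the
  -- moment generating function reduce to a recursion on polynomials.
  have hd : ∀ (p p' : ℝ → ℝ), (∀ t, HasDerivAt p (p' t) t) →
      deriv (fun t => p t * Real.exp (v * t ^ 2 / 2)) =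
        fun t => (p' t + p t * (v * t)) * Real.exp (v * t ^ 2 / 2) := by
    intro p p' hp
    ext t
    have he : HasDerivAt (fun t : ℝ => (v : ℝ) * t ^ 2 / 2) (v * t) t := by
      refine (((hasDerivAt_pow 2 t).const_mul (v : ℝ)).div_const 2).congr_deriv ?_
      norm_num
      ring
    refine (((hp t).mul he.exp).congr_deriv ?_).deriv
    ring
  have hmgf : mgf id (gaussianReal 0 v) = fun t => (1 : ℝ) * Real.exp (v * t ^ 2 / 2) := by
    rw [mgf_id_gaussianReal]
    ext t
    simp
  -- The prefactors are left in the unsimplified form produced by the recursion so that the rewrites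
  -- with `hd` match.
  have p1 : ∀ t : ℝ, HasDerivAt (fun t : ℝ => 0 + 1 * ((v : ℝ) * t)) v t := fun t => by
    simpa using (hasDerivAt_id t).const_mul (v : ℝ)
  have p2 : ∀ t : ℝ, HasDerivAt (fun t : ℝ => (v : ℝ) + (0 + 1 * ((v : ℝ) * t)) * (v * t))
      (2 * (v : ℝ) ^ 2 * t) t := fun t => by
    have := ((hasDerivAt_pow 2 t).const_mul ((v : ℝ) ^ 2)).const_add (v : ℝ)
    refine (this.congr_deriv (by norm_num; ring)).congr_of_eventuallyEq
      (.of_forall fun s => ?_)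
    ring
  have p3 : ∀ t : ℝ, HasDerivAt (fun t : ℝ => 2 * (v : ℝ) ^ 2 * t +
      ((v : ℝ) + (0 + 1 * ((v : ℝ) * t)) * (v * t)) * (v * t))
      (3 * (v : ℝ) ^ 2 + 3 * (v : ℝ) ^ 3 * t ^ 2) t := fun t => by
    have := ((hasDerivAt_id t).const_mul (3 * (v : ℝ) ^ 2)).add
      ((hasDerivAt_pow 3 t).const_mul ((v : ℝ) ^ 3))
    refine (this.congr_deriv (by norm_num; ring)).congr_of_eventuallyEq
      (.of_forall fun s => ?_)
    simp only [Pi.add_apply, id]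
    ring
  rw [hmgf, iteratedDeriv_eq_iterate] at h
  simp only [Function.iterate_succ, Function.iterate_zero, Function.comp_apply, id] at h
  rw [hd _ _ (fun t => hasDerivAt_const t (1 : ℝ)), hd _ _ p1, hd _ _ p2, hd _ _ p3] at h
  simpa using h.symm

variable {S : Matrix (Fin 4) (Fin 4) ℝ}

lemma integral_inner_pow_four_multivariateGaussian (hS : S.PosSemidef)
    (c : EuclideanSpace ℝ (Fin 4)) :
    ∫ x, (inner ℝ c x) ^ 4 ∂(multivariateGaussian 0 S) =
      3 * (c.ofLp ⬝ᵥ S.mulVec c.ofLp) ^ 2 := by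
  set ν := multivariateGaussian (0 : EuclideanSpace ℝ (Fin 4)) S
  have hmap := IsGaussian.map_eq_gaussianReal (μ := ν) (innerSL ℝ c)
  have hmean : ∫ x, innerSL ℝ c x ∂ν = 0 := by
    rw [ContinuousLinearMap.integral_comp_id_comm IsGaussian.integrable_id,
      integral_id_multivariateGaussian, map_zero]
  have hvar : Var[innerSL ℝ c; ν] = c.ofLp ⬝ᵥ S.mulVec c.ofLp := by
    rw [← covarianceBilin_multivariateGaussian (μ := 0) hS,
      covarianceBilin_self IsGaussian.memLp_two_id]
    rfl
  rw [hmean, hvar] at hmap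
  have h := integral_pow_four_gaussianReal (c.ofLp ⬝ᵥ S.mulVec c.ofLp).toNNReal
  rw [← hmap, integral_map (by fun_prop) (by fun_prop)] at h
  rw [Real.coe_toNNReal _ (by rw [← hvar]; exact variance_nonneg _ _)] at h
  exact h

lemma integrable_inner_pow_four_multivariateGaussian (c : EuclideanSpace ℝ (Fin 4)) :
    Integrable (fun x => (inner ℝ c x) ^ 4) (multivariateGaussian 0 S) := by
  have h := IsGaussian.memLp_dual (multivariateGaussian 0 S) (innerSL ℝ c) 4 (by simp)
  have h2 := h.integrable_norm_pow (p := 4) (by norm_num)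
  refine h2.congr (ae_of_all _ fun x => ?_)
  simp only [innerSL_apply_apply, Real.norm_eq_abs]
  exact Even.pow_abs (by decide) _

/-- Isserlis' formula for the fourth mixed moment of a centered Gaussian vector. -/
lemma integral_prod_four_multivariateGaussian (hS : S.PosSemidef) :
    ∫ x, ∏ i, x i ∂(multivariateGaussian 0 S) =
      S 0 1 * S 2 3 + S 0 2 * S 1 3 + S 0 3 * S 1 2 := by
  have hsym : ∀ i j, S i j = S j i := fun i j => by
    have := hS.1.apply i j
    simpa using this.symm
  let c : ℝ → ℝ → ℝ → EuclideanSpace ℝ (Fin 4) := fun p q r => WithLp.toLp 2 ![1, p, q, r]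
  have hc : ∀ p q r (x : EuclideanSpace ℝ (Fin 4)),
      inner ℝ (c p q r) x = x 0 + p * x 1 + q * x 2 + r * x 3 := by
    intro p q r x
    simp [c, PiLp.inner_apply, Fin.sum_univ_four]
    ring
  have hint := fun p q r => integral_inner_pow_four_multivariateGaussian hS (c p q r)
  have hi := fun p q r => integrable_inner_pow_four_multivariateGaussian (S := S) (c p q r)
  -- Polarization: the signed sum of fourth powers over the 8 choices of sign keeps only the fully
  -- mixed term, with coefficient `8 · 4! = 192`.
  have hpol : ∀ x : EuclideanSpace ℝ (Fin 4), ∏ i, x i = (1 / 192 : ℝ) *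
      ((inner ℝ (c 1 1 1) x) ^ 4 - (inner ℝ (c 1 1 (-1)) x) ^ 4 - (inner ℝ (c 1 (-1) 1) x) ^ 4 -
      (inner ℝ (c (-1) 1 1) x) ^ 4 + (inner ℝ (c 1 (-1) (-1)) x) ^ 4 +
      (inner ℝ (c (-1) 1 (-1)) x) ^ 4 + (inner ℝ (c (-1) (-1) 1) x) ^ 4 -
      (inner ℝ (c (-1) (-1) (-1)) x) ^ 4) := by
    intro x
    simp only [hc, Fin.prod_univ_four]
    ring
  simp_rw [hpol]
  rw [integral_const_mul, integral_sub, integral_add, integral_add, integral_add, integral_sub,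
    integral_sub, integral_sub]
  · simp only [hint, c, Matrix.mulVec, dotProduct, Fin.sum_univ_four, Matrix.cons_val,
      hsym 1 0, hsym 2 0, hsym 3 0, hsym 2 1, hsym 3 1, hsym 3 2]
    ring
  all_goals
    repeat' first | exact hi _ _ _ | apply Integrable.sub | apply Integrable.add

/-- The quadratic form at `x` is the variance of `∑ x i * X i`. -/
lemma posSemidef_covariance {Ω ι : Type*} [MeasurableSpace Ω] [Fintype ι] {P : Measure Ω}
    [IsProbabilityMeasure P] {X : ι → Ω → ℝ} (hX : ∀ i, MemLp (X i) 2 P) :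
    (Matrix.of fun i k => cov[X i, X k; P]).PosSemidef := by
  refine .of_dotProduct_mulVec_nonneg ?_ fun x => ?_
  · exact Matrix.IsHermitian.ext fun i k => covariance_comm _ _
  · have hx : ∀ i, MemLp (fun ω => x i * X i ω) 2 P := fun i => (hX i).const_mul _
    have h := covariance_fun_sum_fun_sum hx hx
    rw [covariance_self (Finset.aemeasurable_fun_sum _ fun i _ => (hx i).1.aemeasurable)] at h
    have h0 := variance_nonneg (fun ω => ∑ i, x i * X i ω) P
    rw [h] at h0
    refine h0.trans_eq ?_
    simp only [dotProduct, Matrix.mulVec, Matrix.of_apply, Finset.mul_sum, star_trivial]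
    refine Finset.sum_congr rfl fun i _ => Finset.sum_congr rfl fun k _ => ?_
    rw [covariance_const_mul_left, covariance_const_mul_right]
    ring

/-! ### Second and fourth moments of the errors -/

namespace ErrorCondition

variable {Ω : Type*} [MeasurableSpace Ω] {P : Measure Ω} {u : ℤ → Ω → ℝ}

lemma memLp_two [IsProbabilityMeasure P] (h : ErrorCondition P u) (t : ℤ) : MemLp (u t) 2 P :=
  (h.stationary.memLp_four t).mono_exponent (by norm_num)

lemma memLp_mul (h : ErrorCondition P u) (s t : ℤ) : MemLp (fun ω => u s ω * u t ω) 2 P := by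
  have : ENNReal.HolderTriple 4 4 2 := ⟨by
    rw [← two_mul, show (4 : ℝ≥0∞) = 2 * 2 by norm_num,
      ENNReal.mul_inv (by simp) (by simp), ← mul_assoc, ENNReal.mul_inv_cancel (by simp) (by simp),
      one_mul]⟩
  exact (h.stationary.memLp_four t).mul (h.stationary.memLp_four s)

lemma integrable_mul [IsProbabilityMeasure P] (h : ErrorCondition P u) (s t : ℤ) : Integrable (fun ω => u s ω * u t ω) P :=
  (h.memLp_mul s t).integrable (by norm_num)

lemma integrable_mul_four (h : ErrorCondition P u) (a b c d : ℤ) :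
    Integrable (fun ω => u a ω * u b ω * (u c ω * u d ω)) P :=
  (h.memLp_mul a b).integrable_mul (h.memLp_mul c d)

lemma integral_mul (h : ErrorCondition P u) (s t : ℤ) :
    ∫ ω, u s ω * u t ω ∂P = autocov P u (t - s) := by
  have := h.stationary.moment_shift 2 (by norm_num) ![0, t - s] s
  simpa [Fin.prod_univ_two, autocov] using this

lemma covariance_eq [IsProbabilityMeasure P] (h : ErrorCondition P u) (s t : ℤ) :
    cov[u s, u t; P] = autocov P u (t - s) := by
  rw [covariance_eq_sub (h.memLp_two s) (h.memLp_two t), h.mean_zero s, ← h.integral_mul s t]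
  simp

lemma integral_mul_four [IsProbabilityMeasure P] (h : ErrorCondition P u) (a b c d : ℤ) :
    ∫ ω, u a ω * u b ω * (u c ω * u d ω) ∂P =
      fourthCumulant P u ![0, b - a, c - a, d - a] +
      (autocov P u (b - a) * autocov P u (d - c) + autocov P u (c - a) * autocov P u (d - b) +
        autocov P u (d - a) * autocov P u (c - b)) := by
  have h1 := h.stationary.moment_shift 4 le_rfl ![0, b - a, c - a, d - a] a
  have h2 := integral_prod_four_multivariateGaussian
    (posSemidef_covariance (X := fun i => u (![0, b - a, c - a, d - a] i))
      fun i => h.memLp_two _)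
  have h3 : ∫ ω, u a ω * u b ω * (u c ω * u d ω) ∂P =
      ∫ ω, ∏ i, u (![0, b - a, c - a, d - a] i) ω ∂P := by
    rw [← h1]
    simp [Fin.prod_univ_four, mul_assoc]
  unfold fourthCumulant
  simp only [h.mean_zero, sub_zero]
  rw [h3, show (WithLp.toLp 2 fun _ : Fin 4 => (0 : ℝ)) = 0 from rfl, h2]
  simp only [Matrix.of_apply, h.covariance_eq, Matrix.cons_val, sub_zero, sub_sub_sub_cancel_right]
  ring

end ErrorCondition

/-! ### Moments of weighted sums -/

lemma sum_four_split (J : Finset ℤ) (F G : ℤ → ℤ → ℝ) :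
    ∑ a ∈ J, ∑ b ∈ J, ∑ c ∈ J, ∑ d ∈ J, F a c * G b d =
      (∑ a ∈ J, ∑ c ∈ J, F a c) * ∑ b ∈ J, ∑ d ∈ J, G b d := by
  rw [Finset.sum_mul_sum]
  simp_rw [Finset.sum_mul_sum]

/-- The weighted sum `∑_{t=1}^T w_t u_t`. -/
noncomputable def weightedSum {Ω : Type*} (u : ℤ → Ω → ℝ) (w : ℤ → ℝ) (T : ℕ) (ω : Ω) : ℝ :=
  ∑ t ∈ Finset.Icc (1 : ℤ) T, w t * u t ω

section

variable {Ω : Type*} {u : ℤ → Ω → ℝ} {w v : ℤ → ℝ}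

lemma weightedSum_mul (T : ℕ) (ω : Ω) :
    weightedSum u w T ω * weightedSum u v T ω = ∑ t ∈ Finset.Icc (1 : ℤ) T,
      ∑ s ∈ Finset.Icc (1 : ℤ) T, w t * v s * (u t ω * u s ω) := by
  unfold weightedSum
  rw [Finset.sum_mul_sum]
  exact Finset.sum_congr rfl fun _ _ => Finset.sum_congr rfl fun _ _ => by ring

lemma weightedSum_sq_mul_sq (T : ℕ) (ω : Ω) :
    weightedSum u w T ω ^ 2 * weightedSum u v T ω ^ 2 = ∑ a ∈ Finset.Icc (1 : ℤ) T,
      ∑ b ∈ Finset.Icc (1 : ℤ) T, ∑ c ∈ Finset.Icc (1 : ℤ) T, ∑ d ∈ Finset.Icc (1 : ℤ) T,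
        w a * w b * (v c * v d) * (u a ω * u b ω * (u c ω * u d ω)) := by
  rw [sq, sq, weightedSum_mul, weightedSum_mul, Finset.sum_mul]
  refine Finset.sum_congr rfl fun a _ => ?_
  rw [Finset.sum_mul]
  refine Finset.sum_congr rfl fun b _ => ?_
  rw [Finset.mul_sum]
  refine Finset.sum_congr rfl fun c _ => ?_
  rw [Finset.mul_sum]
  exact Finset.sum_congr rfl fun d _ => by ring

/-- Both `μ` and the sample mean are constant in `t`, and are annihilated since the weights sum to
zero. -/
lemma projCoef_eq {Y : ℤ → Ω → ℝ} {μ : ℝ} (hY : ∀ t ω, Y t ω = μ + u t ω) {T ℓ : ℕ} (hℓ : 0 < ℓ)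
    (hℓT : ℓ < T) (ω : Ω) :
    projCoef Y T ℓ ω = (1 / √(T : ℝ)) * weightedSum u (fun t => basisFun ℓ (t / T)) T ω := by
  unfold projCoef weightedSum residual
  congr 1
  have h := sum_Icc_natCast T fun t : ℤ => basisFun ℓ ((t : ℝ) / T) * (Y t ω - sampleMean Y T ω)
  simp only [Int.cast_natCast] at h
  rw [h]
  have e : ∀ t : ℤ, basisFun ℓ ((t : ℝ) / T) * (Y t ω - sampleMean Y T ω) =
      basisFun ℓ ((t : ℝ) / T) * u t ω + basisFun ℓ ((t : ℝ) / T) * (μ - sampleMean Y T ω) :=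
    fun t => by rw [hY]; ring
  simp_rw [e]
  rw [Finset.sum_add_distrib, ← Finset.sum_mul, sum_basisFun_grid hℓ hℓT]
  ring

variable [MeasurableSpace Ω] {P : Measure Ω}

lemma measurable_weightedSum (hu : ∀ t, Measurable (u t)) (T : ℕ) :
    Measurable (weightedSum u w T) :=
  Finset.measurable_sum _ fun t _ => (hu t).const_mul (w t)

lemma ErrorCondition.integrable_weightedSum_mul [IsProbabilityMeasure P] (h : ErrorCondition P u)
    (T : ℕ) : Integrable (fun ω => weightedSum u w T ω * weightedSum u v T ω) P := by
  simp_rw [weightedSum_mul]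
  exact integrable_finsetSum _ fun t _ => integrable_finsetSum _ fun s _ =>
    (h.integrable_mul t s).const_mul _

lemma ErrorCondition.integrable_weightedSum_sq_mul_sq [IsProbabilityMeasure P]
    (h : ErrorCondition P u) (T : ℕ) :
    Integrable (fun ω => weightedSum u w T ω ^ 2 * weightedSum u v T ω ^ 2) P := by
  simp_rw [weightedSum_sq_mul_sq]
  exact integrable_finsetSum _ fun a _ => integrable_finsetSum _ fun b _ =>
    integrable_finsetSum _ fun c _ => integrable_finsetSum _ fun d _ =>
    (h.integrable_mul_four a b c d).const_mul _

lemma ErrorCondition.integral_weightedSum [IsProbabilityMeasure P] (h : ErrorCondition P u)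
    (T : ℕ) : ∫ ω, weightedSum u w T ω ∂P = 0 := by
  unfold weightedSum
  rw [integral_finsetSum _ fun t _ => ((h.memLp_two t).integrable (by norm_num)).const_mul _]
  simp [integral_const_mul, h.mean_zero]

lemma ErrorCondition.integral_weightedSum_mul [IsProbabilityMeasure P] (h : ErrorCondition P u)
    (T : ℕ) : ∫ ω, weightedSum u w T ω * weightedSum u v T ω ∂P = ∑ t ∈ Finset.Icc (1 : ℤ) T,
      ∑ s ∈ Finset.Icc (1 : ℤ) T, w t * v s * autocov P u (s - t) := by
  simp_rw [weightedSum_mul]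
  rw [integral_finsetSum _ fun t _ => integrable_finsetSum _ fun s _ =>
    (h.integrable_mul t s).const_mul _]
  refine Finset.sum_congr rfl fun t _ => ?_
  rw [integral_finsetSum _ fun s _ => (h.integrable_mul t s).const_mul _]
  exact Finset.sum_congr rfl fun s _ => by rw [integral_const_mul, h.integral_mul]

/-- The fourth cross moment of two weighted sums is that of a Gaussian pair, up to a term governed
by the fourth cumulants. -/
lemma ErrorCondition.abs_integral_weightedSum_sq_mul_sq_sub_le [IsProbabilityMeasure P]
    (h : ErrorCondition P u) {B : ℝ} (hw : ∀ t, |w t| ≤ B) (hv : ∀ t, |v t| ≤ B) (T : ℕ) :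
    |∫ ω, weightedSum u w T ω ^ 2 * weightedSum u v T ω ^ 2 ∂P -
      ((∫ ω, weightedSum u w T ω * weightedSum u w T ω ∂P) *
        (∫ ω, weightedSum u v T ω * weightedSum u v T ω ∂P) +
      2 * (∫ ω, weightedSum u w T ω * weightedSum u v T ω ∂P) ^ 2)| ≤
    T * (B ^ 4 * ∑' k : ℤ × ℤ × ℤ, |fourthCumulant P u ![0, k.1, k.2.1, k.2.2]|) := by
  refine le_of_eq_of_le (congrArg abs ?_) (abs_sum_four_le h.summable_cumulant hw hv T)
  set J := Finset.Icc (1 : ℤ) T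
  have e0 : ∫ ω, weightedSum u w T ω ^ 2 * weightedSum u v T ω ^ 2 ∂P =
      ∑ a ∈ J, ∑ b ∈ J, ∑ c ∈ J, ∑ d ∈ J, w a * w b * (v c * v d) *
        ∫ ω, u a ω * u b ω * (u c ω * u d ω) ∂P := by
    simp_rw [weightedSum_sq_mul_sq]
    rw [integral_finsetSum _ fun a _ => integrable_finsetSum _ fun b _ =>
      integrable_finsetSum _ fun c _ => integrable_finsetSum _ fun d _ =>
      (h.integrable_mul_four a b c d).const_mul _]
    refine Finset.sum_congr rfl fun a _ => ?_
    rw [integral_finsetSum _ fun b _ =>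
      integrable_finsetSum _ fun c _ => integrable_finsetSum _ fun d _ =>
      (h.integrable_mul_four a b c d).const_mul _]
    refine Finset.sum_congr rfl fun b _ => ?_
    rw [integral_finsetSum _ fun c _ => integrable_finsetSum _ fun d _ =>
      (h.integrable_mul_four a b c d).const_mul _]
    refine Finset.sum_congr rfl fun c _ => ?_
    rw [integral_finsetSum _ fun d _ => (h.integrable_mul_four a b c d).const_mul _]
    exact Finset.sum_congr rfl fun d _ => integral_const_mul _ _
  -- The pairing `(ab)(cd)` separates the two weights and yields the product of second moments. The
  -- pairings `(ac)(bd)` and `(ad)(bc)` each yield the squared cross moment, whence the factor 2.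
  have e1 : ∑ a ∈ J, ∑ b ∈ J, ∑ c ∈ J, ∑ d ∈ J, w a * w b * (v c * v d) *
      (autocov P u (b - a) * autocov P u (d - c)) =
      (∫ ω, weightedSum u w T ω * weightedSum u w T ω ∂P) *
        (∫ ω, weightedSum u v T ω * weightedSum u v T ω ∂P) := by
    rw [h.integral_weightedSum_mul, h.integral_weightedSum_mul]
    simp_rw [Finset.sum_mul, Finset.mul_sum]
    exact Finset.sum_congr rfl fun a _ => Finset.sum_congr rfl fun b _ =>
      Finset.sum_congr rfl fun c _ => Finset.sum_congr rfl fun d _ => by ring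
  have e2 : ∑ a ∈ J, ∑ b ∈ J, ∑ c ∈ J, ∑ d ∈ J, w a * w b * (v c * v d) *
      (autocov P u (c - a) * autocov P u (d - b)) =
      (∫ ω, weightedSum u w T ω * weightedSum u v T ω ∂P) ^ 2 := by
    rw [h.integral_weightedSum_mul, sq, ← sum_four_split]
    exact Finset.sum_congr rfl fun a _ => Finset.sum_congr rfl fun b _ =>
      Finset.sum_congr rfl fun c _ => Finset.sum_congr rfl fun d _ => by ring
  have e3 : ∑ a ∈ J, ∑ b ∈ J, ∑ c ∈ J, ∑ d ∈ J, w a * w b * (v c * v d) *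
      (autocov P u (d - a) * autocov P u (c - b)) =
      (∫ ω, weightedSum u w T ω * weightedSum u v T ω ∂P) ^ 2 := by
    rw [h.integral_weightedSum_mul, sq, ← sum_four_split]
    refine Finset.sum_congr rfl fun a _ => Finset.sum_congr rfl fun b _ => ?_
    rw [Finset.sum_comm]
    exact Finset.sum_congr rfl fun c _ => Finset.sum_congr rfl fun d _ => by ring
  rw [e0, two_mul, ← e1]
  nth_rewrite 1 [← e2]
  rw [← e3, sub_eq_iff_eq_add]
  simp_rw [← Finset.sum_add_distrib]
  refine Finset.sum_congr rfl fun a _ => Finset.sum_congr rfl fun b _ =>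
      Finset.sum_congr rfl fun c _ => Finset.sum_congr rfl fun d _ => ?_
  rw [h.integral_mul_four]
  ring

lemma ErrorCondition.summable_abs_mul_autocov (h : ErrorCondition P u) :
    Summable fun k : ℤ => |(k : ℝ)| * |autocov P u k| := by
  refine h.summable_autocov.of_nonneg_of_le (fun k => by positivity) fun k => ?_
  refine mul_le_mul_of_nonneg_right ?_ (abs_nonneg _)
  rcases eq_or_ne k 0 with rfl | hk
  · simp
  · have : (1 : ℝ) ≤ |(k : ℝ)| := by exact_mod_cast Int.one_le_abs hk
    exact le_self_pow₀ this (by norm_num)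

/-- The weight `|k|` is at least 1 except at `k = 0`, whose single term is added separately. -/
lemma ErrorCondition.summable_abs_autocov (h : ErrorCondition P u) :
    Summable fun k : ℤ => |autocov P u k| := by
  have h0 : Summable fun k : ℤ => if k = 0 then |autocov P u 0| else 0 :=
    summable_of_hasFiniteSupport ((Set.finite_singleton (0 : ℤ)).subset fun k hk => by
      by_contra hne
      exact hk (if_neg hne))
  refine (h.summable_abs_mul_autocov.add h0).of_nonneg_of_le (fun k => abs_nonneg _) fun k => ?_
  rcases eq_or_ne k 0 with rfl | hk
  · simp
  · have : (1 : ℝ) ≤ |(k : ℝ)| := by exact_mod_cast Int.one_le_abs hk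
    simpa [hk] using le_mul_of_one_le_left (abs_nonneg (autocov P u k)) this

/-- The long-run variance is the sum of the autocovariances. -/
lemma ErrorCondition.tendsto_integral_weightedSum_one_sq [IsProbabilityMeasure P]
    (h : ErrorCondition P u) :
    Tendsto (fun T : ℕ => (1 / (T : ℝ)) * ∫ ω, weightedSum u 1 T ω * weightedSum u 1 T ω ∂P) atTop
      (𝓝 (∑' k, autocov P u k)) := by
  set M := ∑' k : ℤ, |(k : ℝ)| * |autocov P u k|
  have hM : Tendsto (fun T : ℕ => M * (1 / (T : ℝ))) atTop (𝓝 0) := by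
    simpa using tendsto_one_div_atTop_nhds_zero_nat.const_mul M
  rw [tendsto_iff_norm_sub_tendsto_zero]
  refine squeeze_zero' (.of_forall fun _ => norm_nonneg _) ?_ hM
  filter_upwards [eventually_gt_atTop 0] with T hT
  have hT' : (0 : ℝ) < T := by exact_mod_cast hT
  -- Constant weights have Lipschitz constant 0, so only the boundary term survives.
  have key := abs_toeplitz_sub_le h.summable_abs_autocov h.summable_abs_mul_autocov
    (w := 1) (v := 1) (B := 1) (L := 0) (by norm_num) le_rfl (by simp) (by simp) (by simp) T
  rw [← h.integral_weightedSum_mul] at key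
  have e : (1 / (T : ℝ)) * ∫ ω, weightedSum u 1 T ω * weightedSum u 1 T ω ∂P -
      ∑' k, autocov P u k = (1 / (T : ℝ)) *
      (∫ ω, weightedSum u 1 T ω * weightedSum u 1 T ω ∂P - (∑' k, autocov P u k) *
        ∑ t ∈ Finset.Icc (1 : ℤ) T, (1 : ℤ → ℝ) t * (1 : ℤ → ℝ) t) := by
    simp
    field_simp
  rw [Real.norm_eq_abs, e, abs_mul, abs_of_pos (by positivity), mul_comm]
  refine mul_le_mul_of_nonneg_right (key.trans_eq ?_) (by positivity)
  ring

/-! ### Consistency of the series estimator -/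

/-- Mean-square bound for an average of squares of nearly orthogonal variables whose fourth cross
moments are nearly Gaussian. -/
lemma integral_average_sq_sub_sq_le [IsProbabilityMeasure P] {Z : ℕ → Ω → ℝ} {a : ℕ → ℕ → ℝ}
    {K : ℕ} {S D q : ℝ} (hK : 0 < K)
    (hi2 : ∀ ℓ ∈ Finset.Icc 1 K, Integrable (fun ω => Z ℓ ω ^ 2) P)
    (hi4 : ∀ ℓ ∈ Finset.Icc 1 K, ∀ m ∈ Finset.Icc 1 K, Integrable (fun ω => Z ℓ ω ^ 2 * Z m ω ^ 2) P)
    (ha2 : ∀ ℓ ∈ Finset.Icc 1 K, ∫ ω, Z ℓ ω ^ 2 ∂P = a ℓ ℓ)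
    (ha : ∀ ℓ ∈ Finset.Icc 1 K, ∀ m ∈ Finset.Icc 1 K, |a ℓ m - if ℓ = m then S else 0| ≤ D)
    (ha4 : ∀ ℓ ∈ Finset.Icc 1 K, ∀ m ∈ Finset.Icc 1 K,
      |∫ ω, Z ℓ ω ^ 2 * Z m ω ^ 2 ∂P - (a ℓ ℓ * a m m + 2 * a ℓ m ^ 2)| ≤ q) :
    Integrable (fun ω => ((1 / (K : ℝ)) * ∑ ℓ ∈ Finset.Icc 1 K, Z ℓ ω ^ 2 - S) ^ 2) P ∧
    ∫ ω, ((1 / (K : ℝ)) * ∑ ℓ ∈ Finset.Icc 1 K, Z ℓ ω ^ 2 - S) ^ 2 ∂P ≤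
      q + 5 * D ^ 2 + 4 * S ^ 2 * (1 / (K : ℝ)) := by
  have hK' : (0 : ℝ) < K := by exact_mod_cast hK
  have hexp : ∀ ω, ((1 / (K : ℝ)) * ∑ ℓ ∈ Finset.Icc 1 K, Z ℓ ω ^ 2 - S) ^ 2 =
      (1 / (K : ℝ)) ^ 2 * ∑ ℓ ∈ Finset.Icc 1 K, ∑ m ∈ Finset.Icc 1 K,
        (Z ℓ ω ^ 2 * Z m ω ^ 2 - S * Z ℓ ω ^ 2 - S * Z m ω ^ 2 + S ^ 2) := by
    intro ω
    have h1 : (1 / (K : ℝ)) * ∑ ℓ ∈ Finset.Icc 1 K, Z ℓ ω ^ 2 - S =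
        (1 / (K : ℝ)) * ∑ ℓ ∈ Finset.Icc 1 K, (Z ℓ ω ^ 2 - S) := by
      simp [Finset.sum_sub_distrib]
      field_simp
    rw [h1, mul_pow, sq (∑ ℓ ∈ Finset.Icc 1 K, (Z ℓ ω ^ 2 - S)), Finset.sum_mul_sum]
    congr 1
    exact Finset.sum_congr rfl fun _ _ => Finset.sum_congr rfl fun _ _ => by ring
  have hint : ∀ ℓ ∈ Finset.Icc 1 K, ∀ m ∈ Finset.Icc 1 K, Integrable
      (fun ω => Z ℓ ω ^ 2 * Z m ω ^ 2 - S * Z ℓ ω ^ 2 - S * Z m ω ^ 2 + S ^ 2) P :=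
    fun ℓ hℓ m hm => (((hi4 ℓ hℓ m hm).sub ((hi2 ℓ hℓ).const_mul S)).sub
      ((hi2 m hm).const_mul S)).add (integrable_const _)
  simp_rw [hexp]
  refine ⟨(integrable_finsetSum _ fun ℓ hℓ => integrable_finsetSum _ fun m hm =>
    hint ℓ hℓ m hm).const_mul _, ?_⟩
  rw [integral_const_mul, integral_finsetSum _ fun ℓ hℓ => integrable_finsetSum _ fun m hm =>
    hint ℓ hℓ m hm]
  have hterm : ∀ ℓ ∈ Finset.Icc 1 K, ∫ ω, ∑ m ∈ Finset.Icc 1 K,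
      (Z ℓ ω ^ 2 * Z m ω ^ 2 - S * Z ℓ ω ^ 2 - S * Z m ω ^ 2 + S ^ 2) ∂P ≤
      ∑ m ∈ Finset.Icc 1 K, (q + 5 * D ^ 2 + if ℓ = m then 4 * S ^ 2 else 0) := by
    intro ℓ hℓ
    rw [integral_finsetSum _ fun m hm => hint ℓ hℓ m hm]
    refine Finset.sum_le_sum fun m hm => ?_
    have i1 := hi4 ℓ hℓ m hm
    have i2 := (hi2 ℓ hℓ).const_mul S
    have i3 := (hi2 m hm).const_mul S
    have i12 : Integrable (fun ω => Z ℓ ω ^ 2 * Z m ω ^ 2 - S * Z ℓ ω ^ 2) P := i1.sub i2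
    have i123 : Integrable (fun ω => Z ℓ ω ^ 2 * Z m ω ^ 2 - S * Z ℓ ω ^ 2 - S * Z m ω ^ 2) P :=
      i12.sub i3
    rw [integral_add i123 (integrable_const _), integral_sub i12 i3, integral_sub i1 i2,
      integral_const_mul, integral_const_mul, ha2 ℓ hℓ, ha2 m hm]
    have h4 := (abs_le.1 (ha4 ℓ hℓ m hm)).2
    have hℓℓ := ha ℓ hℓ ℓ hℓ
    have hmm := ha m hm m hm
    rw [if_pos rfl] at hℓℓ hmm
    have hD : 0 ≤ D := (abs_nonneg _).trans hℓℓ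
    have hprod : (a ℓ ℓ - S) * (a m m - S) ≤ D ^ 2 := by
      refine (le_abs_self _).trans ?_
      rw [abs_mul, sq]
      exact mul_le_mul hℓℓ hmm (abs_nonneg _) hD
    have hcross : (a ℓ m - if ℓ = m then S else 0) ^ 2 ≤ D ^ 2 :=
      sq_le_sq' (abs_le.1 (ha ℓ hℓ m hm)).1 (abs_le.1 (ha ℓ hℓ m hm)).2
    have hconst : ∫ _ : Ω, S ^ 2 ∂P = S ^ 2 := by simp
    rw [hconst]
    -- The expected term is at most `q + (a ℓ ℓ - S)(a m m - S) + 2 (a ℓ m)²`. Off the diagonal this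
    -- is at most `q + 3 D²`; on it, `2 a² ≤ 4 (a - S)² + 4 S²` gives `q + 5 D² + 4 S²`.
    split_ifs at hcross ⊢
    · nlinarith [sq_nonneg (a ℓ m - 2 * S)]
    · nlinarith
  calc (1 / (K : ℝ)) ^ 2 * _ ≤ (1 / (K : ℝ)) ^ 2 * ∑ ℓ ∈ Finset.Icc 1 K, ∑ m ∈ Finset.Icc 1 K,
        (q + 5 * D ^ 2 + if ℓ = m then 4 * S ^ 2 else 0) :=
        mul_le_mul_of_nonneg_left (Finset.sum_le_sum hterm) (by positivity)
    _ = (1 / (K : ℝ)) ^ 2 * (K * (K * (q + 5 * D ^ 2)) + K * (4 * S ^ 2)) := by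
        congr 1
        simp_rw [Finset.sum_add_distrib, Finset.sum_ite_eq]
        rw [Finset.sum_ite_mem]
        simp
        ring
    _ = _ := by field_simp

/-- The condition `2 * K < T` keeps every `ℓ + m` below `T`, so orthonormality is exact. With
weights bounded by `√2` and Lipschitz constant `√2 · 2πK / T`, the Toeplitz bound divided by `T`
supplies `D`; the cumulant bound divided by `T²` supplies `q`. -/
lemma ErrorCondition.integral_lrvEstimator_sub_sq_le [IsProbabilityMeasure P]
    (h : ErrorCondition P u) {Y : ℤ → Ω → ℝ} {μ : ℝ} (hY : ∀ t ω, Y t ω = μ + u t ω) {T K : ℕ}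
    (hK : 0 < K) (hKT : 2 * K < T) :
    Integrable (fun ω => (lrvEstimator Y T K ω - ∑' k, autocov P u k) ^ 2) P ∧
    ∫ ω, (lrvEstimator Y T K ω - ∑' k, autocov P u k) ^ 2 ∂P ≤
      4 * (∑' k : ℤ × ℤ × ℤ, |fourthCumulant P u ![0, k.1, k.2.1, k.2.2]|) * (1 / (T : ℝ)) +
      5 * ((4 * Real.pi * ((K : ℝ) / T) + 2 * (1 / (T : ℝ))) *
        ∑' k : ℤ, |(k : ℝ)| * |autocov P u k|) ^ 2 +
      4 * (∑' k, autocov P u k) ^ 2 * (1 / (K : ℝ)) := by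
  have hT : 0 < T := by omega
  have hT' : (0 : ℝ) < T := by exact_mod_cast hT
  have h2 : √2 * √2 = (2 : ℝ) := Real.mul_self_sqrt (by norm_num)
  have hsT : (1 / √(T : ℝ)) * (1 / √(T : ℝ)) = 1 / T := by
    rw [div_mul_div_comm, one_mul, Real.mul_self_sqrt hT'.le]
  set φ : ℕ → ℤ → ℝ := fun ℓ t => basisFun ℓ (t / T) with hφ
  set X : ℕ → Ω → ℝ := fun ℓ => weightedSum u (φ ℓ) T with hX
  have hlrv : ∀ ω, lrvEstimator Y T K ω =
      (1 / (K : ℝ)) * ∑ ℓ ∈ Finset.Icc 1 K, ((1 / √(T : ℝ)) * X ℓ ω) ^ 2 := by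
    intro ω
    unfold lrvEstimator
    congr 1
    refine Finset.sum_congr rfl fun ℓ hℓ => ?_
    rw [Finset.mem_Icc] at hℓ
    rw [projCoef_eq hY (by omega) (by omega)]
  have hsq : ∀ ℓ ω, ((1 / √(T : ℝ)) * X ℓ ω) ^ 2 = 1 / T * (X ℓ ω * X ℓ ω) := fun ℓ ω => by
    rw [← hsT]; ring
  have hfour : ∀ ℓ m ω, ((1 / √(T : ℝ)) * X ℓ ω) ^ 2 * ((1 / √(T : ℝ)) * X m ω) ^ 2 =
      (1 / T) ^ 2 * (X ℓ ω ^ 2 * X m ω ^ 2) := fun ℓ m ω => by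
    rw [← hsT]; ring
  have hbd : ∀ ℓ t, |φ ℓ t| ≤ √2 := fun ℓ t => abs_basisFun_le _ _
  simp_rw [hlrv]
  refine integral_average_sq_sub_sq_le (a := fun ℓ m => 1 / T * ∫ ω, X ℓ ω * X m ω ∂P) hK
    (fun ℓ _ => ?_) (fun ℓ _ m _ => ?_) (fun ℓ _ => ?_) (fun ℓ hℓ m hm => ?_) (fun ℓ _ m _ => ?_)
  · simp_rw [hsq]
    exact (h.integrable_weightedSum_mul T).const_mul _
  · simp_rw [hfour]
    exact (h.integrable_weightedSum_sq_mul_sq T).const_mul _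
  · simp_rw [hsq]
    rw [integral_const_mul]
  · rw [Finset.mem_Icc] at hℓ hm
    have hLip : ∀ t k : ℤ, |φ m (t + k) - φ m t| ≤ √2 * (2 * Real.pi * K) / T * |(k : ℝ)| := by
      intro t k
      refine (abs_basisFun_sub_le m _ _).trans ?_
      have e : ((t + k : ℤ) : ℝ) / T - (t : ℝ) / T = (k : ℝ) / T := by push_cast; ring
      rw [e, abs_div, abs_of_pos hT']
      have hmK : (m : ℝ) ≤ K := by exact_mod_cast hm.2
      calc √2 * (2 * Real.pi * m) * (|(k : ℝ)| / T) ≤ √2 * (2 * Real.pi * K) * (|(k : ℝ)| / T) := by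
            gcongr
        _ = _ := by ring
    have key := abs_toeplitz_sub_le h.summable_abs_autocov h.summable_abs_mul_autocov
      (Real.sqrt_nonneg 2) (by positivity) (hbd ℓ) (hbd m) hLip T
    rw [← h.integral_weightedSum_mul] at key
    have horth := sum_basisFun_mul_basisFun (T := T) (ℓ := ℓ) (m := m) (by omega) (by omega)
      (by omega)
    change |∫ ω, X ℓ ω * X m ω ∂P - (∑' k, autocov P u k) * ∑ t ∈ Finset.Icc (1 : ℤ) T,
      basisFun ℓ ((t : ℝ) / T) * basisFun m ((t : ℝ) / T)| ≤ _ at key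
    rw [horth] at key
    have e : 1 / (T : ℝ) * ∫ ω, X ℓ ω * X m ω ∂P - (if ℓ = m then ∑' k, autocov P u k else 0) =
        1 / T * (∫ ω, X ℓ ω * X m ω ∂P -
          (∑' k, autocov P u k) * if ℓ = m then (T : ℝ) else 0) := by
      split_ifs
      · field_simp
      · simp
    rw [e, abs_mul, abs_of_pos (by positivity)]
    refine (mul_le_mul_of_nonneg_left key (by positivity)).trans_eq ?_
    rw [show √2 * (√2 * (2 * Real.pi * K) / T) = (√2 * √2) * (2 * Real.pi * K) / T by ring,
      sq, h2]
    field_simp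
    ring
  · simp_rw [hfour]
    rw [integral_const_mul]
    have key := h.abs_integral_weightedSum_sq_mul_sq_sub_le (hbd ℓ) (hbd m) T
    have e : ∀ A B C E : ℝ, (1 / (T : ℝ)) ^ 2 * A - (1 / T * B * (1 / T * C) +
        2 * (1 / T * E) ^ 2) = (1 / (T : ℝ)) ^ 2 * (A - (B * C + 2 * E ^ 2)) := fun A B C E => by
      ring
    rw [e, abs_mul, abs_of_pos (by positivity)]
    refine (mul_le_mul_of_nonneg_left key (by positivity)).trans_eq ?_
    rw [show √2 ^ 4 = (√2 * √2) * (√2 * √2) by ring, h2]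
    field_simp
    ring

/-- Chebyshev's inequality applied to the mean-square bound, whose three terms all vanish in the
limit. -/
lemma ErrorCondition.tendstoInMeasure_lrvEstimator [IsProbabilityMeasure P]
    (h : ErrorCondition P u) {Y : ℤ → Ω → ℝ} {μ : ℝ} (hY : ∀ t ω, Y t ω = μ + u t ω)
    {T K : ℕ → ℕ} (hT : Tendsto T atTop atTop) (hK : Tendsto K atTop atTop)
    (hKT : Tendsto (fun n => (K n : ℝ) / (T n : ℝ)) atTop (𝓝 0)) :
    TendstoInMeasure P (fun n => lrvEstimator Y (T n) (K n)) atTop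
      (fun _ => ∑' k, autocov P u k) := by
  set S := ∑' k, autocov P u k with hS
  set Q := ∑' k : ℤ × ℤ × ℤ, |fourthCumulant P u ![0, k.1, k.2.1, k.2.2]| with hQ
  set M := ∑' k : ℤ, |(k : ℝ)| * |autocov P u k| with hM
  have hT0 : Tendsto (fun n => 1 / (T n : ℝ)) atTop (𝓝 0) :=
    tendsto_one_div_atTop_nhds_zero_nat.comp hT
  have hK0 : Tendsto (fun n => 1 / (K n : ℝ)) atTop (𝓝 0) :=
    tendsto_one_div_atTop_nhds_zero_nat.comp hK
  have hlim : Tendsto (fun n => 4 * Q * (1 / (T n : ℝ)) +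
      5 * ((4 * Real.pi * ((K n : ℝ) / T n) + 2 * (1 / (T n : ℝ))) * M) ^ 2 +
      4 * S ^ 2 * (1 / (K n : ℝ))) atTop (𝓝 0) := by
    have := ((hT0.const_mul (4 * Q)).add (((((hKT.const_mul (4 * Real.pi)).add
      (hT0.const_mul 2)).mul_const M).pow 2).const_mul 5)).add (hK0.const_mul (4 * S ^ 2))
    simpa using this
  have hev : ∀ᶠ n in atTop, 0 < K n ∧ 2 * K n < T n := by
    filter_upwards [hK.eventually_gt_atTop 0, hT.eventually_gt_atTop 0,
      hKT.eventually_lt_const (show (0 : ℝ) < 1 / 2 by norm_num)] with n h1 h2 h3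
    refine ⟨h1, ?_⟩
    have h2' : (0 : ℝ) < T n := by exact_mod_cast h2
    rw [div_lt_iff₀ h2'] at h3
    have : (2 : ℝ) * K n < T n := by linarith
    exact_mod_cast this
  rw [tendstoInMeasure_iff_measureReal_norm]
  intro ε hε
  have hlim' := hlim.const_mul (1 / ε ^ 2)
  rw [mul_zero] at hlim'
  refine squeeze_zero' (.of_forall fun _ => measureReal_nonneg) ?_ hlim'
  filter_upwards [hev] with n hn
  obtain ⟨hi, hle⟩ := h.integral_lrvEstimator_sub_sq_le hY hn.1 hn.2
  have hmk := mul_meas_ge_le_integral_of_nonneg (μ := P)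
    (ae_of_all _ fun ω => sq_nonneg (lrvEstimator Y (T n) (K n) ω - S)) hi (ε ^ 2)
  have hset : {ω | ε ^ 2 ≤ (lrvEstimator Y (T n) (K n) ω - S) ^ 2} =
      {ω | ε ≤ ‖lrvEstimator Y (T n) (K n) ω - S‖} := by
    ext ω
    simp only [Set.mem_ofPred_eq, Real.norm_eq_abs]
    rw [← sq_abs (_ - S), sq_le_sq₀ hε.le (abs_nonneg _)]
  rw [hset] at hmk
  rw [one_div, inv_mul_eq_div, le_div_iff₀ (by positivity), mul_comm]
  exact hmk.trans hle

end

section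

variable {Ω : Type*}

/-! ### The central limit theorem for the sample means -/

/-- The normalized sum `T^{-1/2} ∑_{t=1}^T u_t`. -/
noncomputable def normalizedSum (u : ℤ → Ω → ℝ) (T : ℕ) (ω : Ω) : ℝ :=
  (1 / √(T : ℝ)) * weightedSum u 1 T ω

lemma normalizedSum_sq (u : ℤ → Ω → ℝ) (T : ℕ) (ω : Ω) :
    normalizedSum u T ω ^ 2 = (1 / (T : ℝ)) * (weightedSum u 1 T ω * weightedSum u 1 T ω) := by
  have h : √(T : ℝ) ^ 2 = T := Real.sq_sqrt (Nat.cast_nonneg T)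
  unfold normalizedSum
  rw [mul_pow, div_pow, one_pow, h, sq]

lemma sampleMean_eq {Y u : ℤ → Ω → ℝ} {μ : ℝ} (hY : ∀ t ω, Y t ω = μ + u t ω) {T : ℕ} (hT : 0 < T)
    (ω : Ω) : sampleMean Y T ω = μ + (1 / √(T : ℝ)) * normalizedSum u T ω := by
  have hT' : (0 : ℝ) < T := by exact_mod_cast hT
  have hsT : (1 / √(T : ℝ)) * (1 / √(T : ℝ)) = 1 / T := by
    rw [div_mul_div_comm, one_mul, Real.mul_self_sqrt hT'.le]
  unfold sampleMean normalizedSum weightedSum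
  rw [sum_Icc_natCast T fun t => Y t ω, ← mul_assoc, hsT]
  simp_rw [hY]
  rw [Finset.sum_add_distrib]
  simp
  field_simp

lemma partialSumPath_one (u : Fin 2 → ℤ → Ω → ℝ) (T : ℕ) (ω : Ω) (j : Fin 2) :
    partialSumPath u T ω 1 j = normalizedSum (u j) T ω := by
  unfold partialSumPath normalizedSum weightedSum
  rw [Set.Icc.coe_one, one_mul, Nat.floor_natCast, sum_Icc_natCast T fun t => u j t ω]
  simp

variable [MeasurableSpace Ω] {P : Measure Ω}

lemma measurable_normalizedSum {u : ℤ → Ω → ℝ} (hu : ∀ t, Measurable (u t)) (T : ℕ) :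
    Measurable (normalizedSum u T) :=
  (measurable_weightedSum hu T).const_mul _

/-- Every time change fixes the endpoint 1, so closeness of paths in the Skorokhod sense controls
the values there. -/
lemma skorokhodContinuous_comp_eval_one {f : ℝ → ℝ} (hf : Continuous f) (j : Fin 2) :
    SkorokhodContinuous fun x => f (x 1 j) := by
  intro x _ ε hε
  obtain ⟨δ, hδ, h⟩ := Metric.continuous_iff.1 hf (x 1 j) ε hε
  refine ⟨δ, hδ, fun y _ ⟨τ, _, hτ⟩ => h _ ?_⟩
  have h1 := hτ 1
  rw [show τ 1 = 1 from τ.map_top] at h1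
  exact (norm_le_pi_norm (y 1 - x 1) j).trans_lt h1

lemma hasLaw_scaledBrownianPath_one {Ω' : Type*} [MeasurableSpace Ω'] {P' : Measure Ω'}
    {W : Fin 2 → ℝ≥0 → Ω' → ℝ} (hW : IsBrownianMotion2 P' W) {v : Fin 2 → ℝ} {j : Fin 2}
    (hv : 0 ≤ v j) :
    HasLaw (fun ω => scaledBrownianPath v W ω 1 j) (gaussianReal 0 (v j).toNNReal) P' := by
  have h := gaussianReal_const_mul ((hW.brownian j).hasLaw_eval 1) √(v j)
  have e : (NNReal.mk (√(v j) ^ 2) (sq_nonneg _) * 1 : ℝ≥0) = (v j).toNNReal := by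
    ext
    simp [Real.sq_sqrt hv, hv]
  rw [mul_zero, e] at h
  exact h

variable [IsProbabilityMeasure P]

/-- The central limit theorem at time one contained in the functional central limit theorem. -/
lemma tendsto_charFun_normalizedSum {Ω' : Type*} [MeasurableSpace Ω'] {P' : Measure Ω'}
    [IsProbabilityMeasure P'] {u : Fin 2 → ℤ → Ω → ℝ} (hu : ∀ j t, Measurable (u j t))
    {v : Fin 2 → ℝ} {W : Fin 2 → ℝ≥0 → Ω' → ℝ} (hW : IsBrownianMotion2 P' W)
    (hF : TendstoInSkorokhod P (partialSumPath u) P' (scaledBrownianPath v W)) {j : Fin 2}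
    (hv : 0 ≤ v j) (s : ℝ) :
    Tendsto (fun T => charFun (P.map (normalizedSum (u j) T)) s) atTop
      (𝓝 (Complex.exp (-(v j * s ^ 2 / 2 : ℝ)))) := by
  have hm := fun T => measurable_normalizedSum (hu j) T
  have hlaw := hasLaw_scaledBrownianPath_one hW hv
  let μs : ℕ → ProbabilityMeasure ℝ := fun T =>
    ⟨P.map (normalizedSum (u j) T), Measure.isProbabilityMeasure_map (hm T).aemeasurable⟩
  let μ₀ : ProbabilityMeasure ℝ := ⟨gaussianReal 0 (v j).toNNReal, inferInstance⟩
  have hconv : Tendsto μs atTop (𝓝 μ₀) := by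
    rw [ProbabilityMeasure.tendsto_iff_forall_integral_tendsto]
    intro f
    have h := hF (fun x => f (x 1 j)) ⟨‖f‖, fun x => f.norm_coe_le_norm _⟩
      (skorokhodContinuous_comp_eval_one f.continuous j)
    simp_rw [partialSumPath_one] at h
    have e1 : ∀ T, ∫ x, f x ∂(μs T : Measure ℝ) = ∫ ω, f (normalizedSum (u j) T ω) ∂P := fun T =>
      integral_map (hm T).aemeasurable f.continuous.aestronglyMeasurable
    have e2 : ∫ x, f x ∂(μ₀ : Measure ℝ) = ∫ ω, f (scaledBrownianPath v W ω 1 j) ∂P' := by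
      change ∫ x, f x ∂(gaussianReal 0 (v j).toNNReal) = _
      rw [← hlaw.map_eq]
      exact integral_map hlaw.aemeasurable f.continuous.aestronglyMeasurable
    simp_rw [e1, e2]
    exact h
  have h := ProbabilityMeasure.tendsto_iff_tendsto_charFun.1 hconv s
  change Tendsto (fun T => charFun (P.map (normalizedSum (u j) T)) s) atTop
    (𝓝 (charFun (gaussianReal 0 (v j).toNNReal) s)) at h
  rw [charFun_gaussianReal, Real.coe_toNNReal _ hv] at h
  rw [show (-(v j * s ^ 2 / 2 : ℝ) : ℂ) = s * (0 : ℝ) * Complex.I - (v j : ℝ) * s ^ 2 / 2 by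
    push_cast; ring]
  exact h

/-- From `|exp(isX) - exp(is'X)| ≤ |s - s'| |X|` and `|X| ≤ 1 + X²`. Bounded second moments thus
make a family of characteristic functions equicontinuous. -/
lemma norm_charFun_map_sub_le {X : Ω → ℝ} (hX : Measurable X)
    (hX2 : Integrable (fun ω => X ω ^ 2) P) (s s' : ℝ) :
    ‖charFun (P.map X) s - charFun (P.map X) s'‖ ≤ |s - s'| * (1 + ∫ ω, X ω ^ 2 ∂P) := by
  have hexp : ∀ r : ℝ, Integrable (fun ω => Complex.exp (r * X ω * Complex.I)) P := fun r => by
    refine Integrable.of_bound (by fun_prop) 1 (ae_of_all _ fun ω => ?_)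
    rw [← Complex.ofReal_mul, Complex.norm_exp_ofReal_mul_I]
  have hchar : ∀ r : ℝ, charFun (P.map X) r = ∫ ω, Complex.exp (r * X ω * Complex.I) ∂P :=
    fun r => by
    rw [charFun_apply_real, integral_map hX.aemeasurable (by fun_prop)]
  rw [hchar, hchar, ← integral_sub (hexp s) (hexp s')]
  have hdom : Integrable (fun ω => |s - s'| * (1 + X ω ^ 2)) P :=
    ((integrable_const _).add hX2).const_mul _
  refine (norm_integral_le_of_norm_le hdom (ae_of_all _ fun ω => ?_)).trans_eq ?_
  · have e : Complex.exp (s * X ω * Complex.I) - Complex.exp (s' * X ω * Complex.I) =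
        Complex.exp ((s' * X ω : ℝ) * Complex.I) *
          (Complex.exp (Complex.I * ((s - s') * X ω : ℝ)) - 1) := by
      rw [mul_sub, ← Complex.exp_add, mul_one]
      push_cast
      ring_nf
    rw [e, norm_mul, Complex.norm_exp_ofReal_mul_I, one_mul]
    refine Real.norm_exp_I_mul_ofReal_sub_one_le.trans ?_
    rw [norm_mul, Real.norm_eq_abs, Real.norm_eq_abs]
    refine mul_le_mul_of_nonneg_left ?_ (abs_nonneg _)
    rw [← sq_abs (X ω)]
    nlinarith [sq_nonneg (|X ω| - 1), abs_nonneg (X ω)]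
  · rw [integral_const_mul, integral_add (integrable_const _) hX2]
    simp

/-- Characteristic functions of the normalized sums converge along convergent arguments. -/
lemma ErrorCondition.tendsto_charFun_normalizedSum_comp {u : ℤ → Ω → ℝ} (h : ErrorCondition P u)
    {v : ℝ} (hchar : ∀ s : ℝ, Tendsto (fun T => charFun (P.map (normalizedSum u T)) s) atTop
      (𝓝 (Complex.exp (-(v * s ^ 2 / 2 : ℝ))))) {ι : Type*} {l : Filter ι} {T : ι → ℕ} {c : ι → ℝ}
    {c₀ : ℝ} (hT : Tendsto T l atTop) (hc : Tendsto c l (𝓝 c₀)) :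
    Tendsto (fun n => charFun (P.map (normalizedSum u (T n))) (c n)) l
      (𝓝 (Complex.exp (-(v * c₀ ^ 2 / 2 : ℝ)))) := by
  have hsq : Tendsto (fun T => ∫ ω, normalizedSum u T ω ^ 2 ∂P) atTop
      (𝓝 (∑' k, autocov P u k)) := by
    simp_rw [normalizedSum_sq, integral_const_mul]
    exact h.tendsto_integral_weightedSum_one_sq
  have hdiff : Tendsto (fun n => charFun (P.map (normalizedSum u (T n))) (c n) -
      charFun (P.map (normalizedSum u (T n))) c₀) l (𝓝 0) := by
    refine squeeze_zero_norm (fun n => norm_charFun_map_sub_le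
      (measurable_normalizedSum h.stationary.measurable _) ?_ _ _) ?_
    · simp_rw [normalizedSum_sq]
      exact (h.integrable_weightedSum_mul _).const_mul _
    · have h1 : Tendsto (fun n => |c n - c₀|) l (𝓝 0) := by
        simpa using (hc.sub_const c₀).abs
      simpa using h1.mul ((hsq.comp hT).const_add 1)
  simpa using hdiff.add ((hchar c₀).comp hT)

/-- The rescaled sample mean is a centered normalized sum, so its variance is the second moment
whose limit is already known; limits are unique. -/
lemma ErrorCondition.longRunVariance_eq {Y u : ℤ → Ω → ℝ} (h : ErrorCondition P u) {μ v : ℝ}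
    (hY : ∀ t ω, Y t ω = μ + u t ω) (hv : IsLongRunVariance P Y μ v) :
    v = ∑' k, autocov P u k := by
  refine tendsto_nhds_unique hv (h.tendsto_integral_weightedSum_one_sq.congr' ?_)
  filter_upwards [eventually_gt_atTop 0] with T hT
  have hs : √(T : ℝ) ≠ 0 := by
    have : (0 : ℝ) < T := by exact_mod_cast hT
    positivity
  have e : (fun ω => √(T : ℝ) * (sampleMean Y T ω - μ)) = normalizedSum u T := by
    ext ω
    rw [sampleMean_eq hY hT, add_sub_cancel_left]
    field_simp
  have hmean : ∫ ω, normalizedSum u T ω ∂P = 0 := by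
    unfold normalizedSum
    rw [integral_const_mul, h.integral_weightedSum, mul_zero]
  rw [e, variance_of_integral_eq_zero
    (measurable_normalizedSum h.stationary.measurable T).aemeasurable hmean]
  simp_rw [normalizedSum_sq]
  rw [integral_const_mul]

/-! ### The two-sample statistic -/

lemma measurable_sampleMean {Y : ℤ → Ω → ℝ} (hY : ∀ t, Measurable (Y t)) (T : ℕ) :
    Measurable (sampleMean Y T) := by
  unfold sampleMean
  fun_prop

lemma measurable_projCoef {Y : ℤ → Ω → ℝ} (hY : ∀ t, Measurable (Y t)) (T ℓ : ℕ) :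
    Measurable (projCoef Y T ℓ) := by
  have := measurable_sampleMean hY T
  unfold projCoef residual
  fun_prop

lemma measurable_lrvEstimator {Y : ℤ → Ω → ℝ} (hY : ∀ t, Measurable (Y t)) (T K : ℕ) :
    Measurable (lrvEstimator Y T K) := by
  have := measurable_projCoef hY T
  unfold lrvEstimator
  fun_prop

/-- The difference of the sample means, standardized by the true long-run variances, is
asymptotically standard normal. -/
lemma tendstoInDistribution_standardized_sub {Y u : Fin 2 → ℤ → Ω → ℝ} {μ v : Fin 2 → ℝ}
    (hY : ∀ j t ω, Y j t ω = μ j + u j t ω)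
    (hindep : IndepFun (fun ω t => u 0 t ω) (fun ω t => u 1 t ω) P) (hv : ∀ j, 0 < v j)
    (herr : ∀ j, ErrorCondition P (u j))
    (hchar : ∀ (j : Fin 2) (s : ℝ), Tendsto (fun T => charFun (P.map (normalizedSum (u j) T)) s)
      atTop (𝓝 (Complex.exp (-(v j * s ^ 2 / 2 : ℝ)))))
    {T : Fin 2 → ℕ → ℕ} (hT : ∀ j, Tendsto (T j) atTop atTop) (hμ : μ 0 = μ 1) :
    TendstoInDistribution (fun n ω => (sampleMean (Y 0) (T 0 n) ω - sampleMean (Y 1) (T 1 n) ω) /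
      √(v 0 / (T 0 n : ℝ) + v 1 / (T 1 n : ℝ))) atTop (id : ℝ → ℝ) (fun _ => P)
      (gaussianReal 0 1) := by
  have hYm : ∀ j t, Measurable (Y j t) := fun j t => by
    rw [show Y j t = fun ω => μ j + u j t ω from funext (hY j t)]
    exact ((herr j).stationary.measurable t).const_add _
  have hXm : ∀ n, Measurable fun ω => (sampleMean (Y 0) (T 0 n) ω - sampleMean (Y 1) (T 1 n) ω) /
      √(v 0 / (T 0 n : ℝ) + v 1 / (T 1 n : ℝ)) := fun n =>
    ((measurable_sampleMean (hYm 0) _).sub (measurable_sampleMean (hYm 1) _)).div_const _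
  refine ⟨fun n => (hXm n).aemeasurable, aemeasurable_id, ?_⟩
  refine ProbabilityMeasure.tendsto_iff_tendsto_charFun.2 fun s => ?_
  change Tendsto (fun n => charFun (P.map fun ω => (sampleMean (Y 0) (T 0 n) ω -
    sampleMean (Y 1) (T 1 n) ω) / √(v 0 / (T 0 n : ℝ) + v 1 / (T 1 n : ℝ))) s) atTop
    (𝓝 (charFun ((gaussianReal 0 1).map id) s))
  rw [Measure.map_id, charFun_gaussianReal]
  set V : ℕ → ℝ := fun n => √(v 0 / (T 0 n : ℝ) + v 1 / (T 1 n : ℝ)) with hV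
  set a : ℕ → ℝ := fun n => 1 / √(T 0 n : ℝ) / V n with ha
  set b : ℕ → ℝ := fun n => -(1 / √(T 1 n : ℝ) / V n) with hb
  have hpos : ∀ᶠ n in atTop, 0 < T 0 n ∧ 0 < T 1 n :=
    ((hT 0).eventually_gt_atTop 0).and ((hT 1).eventually_gt_atTop 0)
  -- The weights `a n`, `b n` on the two normalized sums, the second carrying the minus sign, are
  -- scaled to unit asymptotic variance. This identity also bounds them.
  have hab : ∀ᶠ n in atTop, v 0 * a n ^ 2 + v 1 * b n ^ 2 = 1 := by
    filter_upwards [hpos] with n hn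
    have h0 : (0 : ℝ) < T 0 n := by exact_mod_cast hn.1
    have h1 : (0 : ℝ) < T 1 n := by exact_mod_cast hn.2
    have hv0 := hv 0
    have hv1 := hv 1
    have hs : 0 < v 0 / (T 0 n : ℝ) + v 1 / (T 1 n : ℝ) := by positivity
    have hV2 : V n ^ 2 = v 0 / (T 0 n : ℝ) + v 1 / (T 1 n : ℝ) := Real.sq_sqrt hs.le
    simp only [ha, hb]
    rw [neg_sq, div_pow, div_pow, div_pow, div_pow, Real.sq_sqrt h0.le, Real.sq_sqrt h1.le, hV2,
      one_pow]
    field_simp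
  have hbound : ∀ᶠ n in atTop, a n ∈ Set.Icc (-√(1 / v 0)) √(1 / v 0) ∧
      b n ∈ Set.Icc (-√(1 / v 1)) √(1 / v 1) := by
    filter_upwards [hab] with n hn
    have h0 : a n ^ 2 ≤ 1 / v 0 := by
      rw [le_div_iff₀ (hv 0)]
      nlinarith [mul_nonneg (hv 1).le (sq_nonneg (b n))]
    have h1 : b n ^ 2 ≤ 1 / v 1 := by
      rw [le_div_iff₀ (hv 1)]
      nlinarith [mul_nonneg (hv 0).le (sq_nonneg (a n))]
    exact ⟨Set.mem_Icc.2 (abs_le.1 (Real.abs_le_sqrt h0)),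
      Set.mem_Icc.2 (abs_le.1 (Real.abs_le_sqrt h1))⟩
  have hZm : ∀ j n, Measurable (normalizedSum (u j) n) := fun j n =>
    measurable_normalizedSum (herr j).stationary.measurable n
  have hfact : ∀ᶠ n in atTop, charFun (P.map fun ω => (sampleMean (Y 0) (T 0 n) ω -
      sampleMean (Y 1) (T 1 n) ω) / V n) s =
      charFun (P.map (normalizedSum (u 0) (T 0 n))) (a n * s) *
      charFun (P.map (normalizedSum (u 1) (T 1 n))) (b n * s) := by
    filter_upwards [hpos] with n hn
    have e : (fun ω => (sampleMean (Y 0) (T 0 n) ω - sampleMean (Y 1) (T 1 n) ω) / V n) =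
        fun ω => a n * normalizedSum (u 0) (T 0 n) ω + b n * normalizedSum (u 1) (T 1 n) ω := by
      ext ω
      rw [sampleMean_eq (hY 0) hn.1, sampleMean_eq (hY 1) hn.2, hμ]
      simp only [ha, hb]
      ring
    have hg : ∀ (c : ℝ) (m : ℕ), Measurable fun x : ℤ → ℝ =>
        c * ((1 / √(m : ℝ)) * ∑ t ∈ Finset.Icc (1 : ℤ) m, (1 : ℤ → ℝ) t * x t) := fun c m =>
      ((Finset.measurable_sum _ fun t _ => (measurable_pi_apply t).const_mul _).const_mul _).const_mul _
    have hi : IndepFun (fun ω => a n * normalizedSum (u 0) (T 0 n) ω)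
        (fun ω => b n * normalizedSum (u 1) (T 1 n) ω) P :=
      hindep.comp (hg (a n) (T 0 n)) (hg (b n) (T 1 n))
    rw [e, hi.charFun_map_fun_add_eq_mul ((hZm 0 _).const_mul _).aemeasurable
      ((hZm 1 _).const_mul _).aemeasurable, Pi.mul_apply,
      charFun_map_mul_comp (hZm 0 _).aemeasurable, charFun_map_mul_comp (hZm 1 _).aemeasurable]
  refine Tendsto.congr' (hfact.mono fun n hn => hn.symm) ?_
  -- Along an ultrafilter the bounded weights converge even when the ratio of sample sizes does not.
  -- The limits `a₀`, `b₀` inherit the unit-variance identity, which removes them from the limiting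
  -- characteristic function.
  rw [tendsto_iff_ultrafilter]
  intro g hg
  obtain ⟨a₀, -, ha₀⟩ := (isCompact_Icc (a := -√(1 / v 0)) (b := √(1 / v 0))).ultrafilter_le_nhds
    (g.map a) (tendsto_principal.2 (hg (hbound.mono fun n hn => hn.1)))
  obtain ⟨b₀, -, hb₀⟩ := (isCompact_Icc (a := -√(1 / v 1)) (b := √(1 / v 1))).ultrafilter_le_nhds
    (g.map b) (tendsto_principal.2 (hg (hbound.mono fun n hn => hn.2)))
  have hat : Tendsto a g (𝓝 a₀) := ha₀
  have hbt : Tendsto b g (𝓝 b₀) := hb₀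
  have hlim1 : v 0 * a₀ ^ 2 + v 1 * b₀ ^ 2 = 1 :=
    tendsto_nhds_unique (((hat.pow 2).const_mul (v 0)).add ((hbt.pow 2).const_mul (v 1)))
      (tendsto_const_nhds.congr' (hg (hab.mono fun n hn => hn.symm)))
  have key := ((herr 0).tendsto_charFun_normalizedSum_comp (hchar 0) ((hT 0).mono_left hg)
    (hat.mul_const s)).mul ((herr 1).tendsto_charFun_normalizedSum_comp (hchar 1)
    ((hT 1).mono_left hg) (hbt.mul_const s))
  rw [← Complex.exp_add, ← Complex.ofReal_neg, ← Complex.ofReal_neg, ← Complex.ofReal_add] at key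
  rw [show -(v 0 * (a₀ * s) ^ 2 / 2) + -(v 1 * (b₀ * s) ^ 2 / 2) = -(s ^ 2 / 2) by
    linear_combination (-(s ^ 2) / 2) * hlim1] at key
  convert key using 3
  push_cast
  ring

/-- The ratio of the true to the estimated standard error tends to one in probability. -/
lemma tendstoInMeasure_ratio {A : Fin 2 → ℕ → Ω → ℝ} {v : Fin 2 → ℝ} (hv : ∀ j, 0 < v j)
    (hA : ∀ j, TendstoInMeasure P (A j) atTop fun _ => v j) {T : Fin 2 → ℕ → ℕ}
    (hT : ∀ j, Tendsto (T j) atTop atTop) :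
    TendstoInMeasure P (fun n ω => √(v 0 / (T 0 n : ℝ) + v 1 / (T 1 n : ℝ)) /
      √(A 0 n ω / (T 0 n : ℝ) + A 1 n ω / (T 1 n : ℝ))) atTop fun _ => 1 := by
  simp only [tendstoInMeasure_iff_measureReal_norm] at hA ⊢
  intro ε hε
  have hcont : ContinuousAt (fun x : ℝ => (√x)⁻¹) 1 :=
    Real.continuous_sqrt.continuousAt.inv₀ (by simp)
  obtain ⟨δ, hδ, hδε⟩ := Metric.continuousAt_iff.1 hcont ε hε
  -- Errors below `δ / 2 * v j` in each estimate give relative error below `δ` in the weighted sum,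
  -- whatever the sample sizes.
  have hlim := (hA 0 (δ / 2 * v 0) (mul_pos (half_pos hδ) (hv 0))).add
    (hA 1 (δ / 2 * v 1) (mul_pos (half_pos hδ) (hv 1)))
  rw [add_zero] at hlim
  refine squeeze_zero' (.of_forall fun _ => measureReal_nonneg) ?_ hlim
  filter_upwards [(hT 0).eventually_gt_atTop 0, (hT 1).eventually_gt_atTop 0] with n hn0 hn1
  have h0 : (0 : ℝ) < T 0 n := by exact_mod_cast hn0
  have h1 : (0 : ℝ) < T 1 n := by exact_mod_cast hn1
  have hv0 := div_pos (hv 0) h0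
  have hv1 := div_pos (hv 1) h1
  refine (measureReal_mono fun ω hω => ?_).trans (measureReal_union_le _ _)
  by_contra hnot
  simp only [Set.mem_union, Set.mem_ofPred_eq, not_or, not_le, Real.norm_eq_abs] at hnot hω
  refine absurd hω (not_le.2 ?_)
  set V := v 0 / (T 0 n : ℝ) + v 1 / (T 1 n : ℝ) with hV
  have hVpos : 0 < V := by positivity
  have hx : dist ((A 0 n ω / (T 0 n : ℝ) + A 1 n ω / (T 1 n : ℝ)) / V) 1 < δ := by
    have e : (A 0 n ω / (T 0 n : ℝ) + A 1 n ω / (T 1 n : ℝ)) / V - 1 =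
        ((A 0 n ω - v 0) / T 0 n + (A 1 n ω - v 1) / T 1 n) / V := by
      rw [div_sub_one hVpos.ne', hV]
      congr 1
      ring
    rw [Real.dist_eq, e, abs_div, abs_of_pos hVpos, div_lt_iff₀ hVpos]
    refine (abs_add_le _ _).trans_lt ?_
    rw [abs_div, abs_div, abs_of_pos h0, abs_of_pos h1]
    have k0 : |A 0 n ω - v 0| / T 0 n < δ / 2 * v 0 / T 0 n := div_lt_div_of_pos_right hnot.1 h0
    have k1 : |A 1 n ω - v 1| / T 1 n < δ / 2 * v 1 / T 1 n := div_lt_div_of_pos_right hnot.2 h1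
    have k2 : δ / 2 * v 0 / T 0 n + δ / 2 * v 1 / T 1 n = δ / 2 * V := by
      rw [hV]; ring
    have k3 : 0 < δ * V := mul_pos hδ hVpos
    linarith
  have h := hδε hx
  rw [Real.sqrt_div' _ hVpos.le, inv_div, Real.sqrt_one, inv_one, Real.dist_eq] at h
  exact h

end

end SeriesHAR

theorem theorem2 {Ω : Type*} [MeasurableSpace Ω] (P : Measure Ω) [IsProbabilityMeasure P]
    {Ω' : Type*} [MeasurableSpace Ω'] (P' : Measure Ω') [IsProbabilityMeasure P']
    -- the data `Y j t = μ j + u j t`, with independent error series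
    (Y u : Fin 2 → ℤ → Ω → ℝ) (μ : Fin 2 → ℝ)
    (hY : ∀ j t ω, Y j t ω = μ j + u j t ω)
    (hindep : IndepFun (fun ω t => u 0 t ω) (fun ω t => u 1 t ω) P)
    -- the long-run variances
    (lrv : Fin 2 → ℝ) (hlrv_pos : ∀ j, 0 < lrv j)
    (hlrv : ∀ j, SeriesHAR.IsLongRunVariance P (Y j) (μ j) (lrv j))
    -- the functional central limit theorem
    (W : Fin 2 → ℝ≥0 → Ω' → ℝ) (hW : SeriesHAR.IsBrownianMotion2 P' W)
    (hFCLT : SeriesHAR.TendstoInSkorokhod P (SeriesHAR.partialSumPath u)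
      P' (SeriesHAR.scaledBrownianPath lrv W))
    -- stationarity and summability
    (herr : ∀ j, SeriesHAR.ErrorCondition P (u j))
    -- sample sizes and numbers of basis functions
    (T K : Fin 2 → ℕ → ℕ)
    (hT : ∀ j, Tendsto (T j) atTop atTop) (hK : ∀ j, Tendsto (K j) atTop atTop)
    (hKT : ∀ j, Tendsto (fun n => (K j n : ℝ) / (T j n : ℝ)) atTop (𝓝 0)) :
    (∀ j, TendstoInMeasure P (fun n => SeriesHAR.lrvEstimator (Y j) (T j n) (K j n)) atTop
      (fun _ => lrv j)) ∧
    (μ 0 = μ 1 →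
      TendstoInDistribution
        (fun n => SeriesHAR.tStatHAR Y (fun j => T j n) (fun j => K j n)) atTop
        (id : ℝ → ℝ) (fun _ => P) (gaussianReal 0 1)) := by
  have hcons : ∀ j, TendstoInMeasure P
      (fun n => SeriesHAR.lrvEstimator (Y j) (T j n) (K j n)) atTop (fun _ => lrv j) := fun j => by
    rw [(herr j).longRunVariance_eq (hY j) (hlrv j)]
    exact (herr j).tendstoInMeasure_lrvEstimator (hY j) (hT j) (hK j) (hKT j)
  refine ⟨hcons, fun hμ => ?_⟩
  have hYm : ∀ j t, Measurable (Y j t) := fun j t => by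
    rw [show Y j t = fun ω => μ j + u j t ω from funext (hY j t)]
    exact ((herr j).stationary.measurable t).const_add _
  have hchar := fun (j : Fin 2) (s : ℝ) => SeriesHAR.tendsto_charFun_normalizedSum
    (fun j => (herr j).stationary.measurable) hW hFCLT (hlrv_pos j).le s
  have hX := SeriesHAR.tendstoInDistribution_standardized_sub hY hindep hlrv_pos herr hchar hT hμ
  have hR := SeriesHAR.tendstoInMeasure_ratio hlrv_pos hcons hT
  -- Slutsky's theorem for the product of the standardized difference and the ratio of standard
  -- errors.
  have h := hX.continuous_comp_prodMk_of_tendstoInMeasure_const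
    (g := fun p : ℝ × ℝ => p.1 * p.2) (by fun_prop) hR fun n =>
      ((((SeriesHAR.measurable_lrvEstimator (hYm 0) _ _).div_const _).add
        ((SeriesHAR.measurable_lrvEstimator (hYm 1) _ _).div_const _)).sqrt.const_div _).aemeasurable
  refine h.congr (fun n => ae_of_all _ fun ω => ?_) (ae_of_all _ fun x => mul_one x)
  have h0 := (hlrv_pos 0).le
  have h1 := (hlrv_pos 1).le
  simp only [SeriesHAR.tStatHAR]
  -- The true standard error cancels unless it is 0. By division by zero this happens only when both
  -- sample sizes are 0, and then the sample means, hence both sides, are 0.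
  rcases eq_or_ne √(lrv 0 / (T 0 n : ℝ) + lrv 1 / (T 1 n : ℝ)) 0 with hV | hV
  · have hT0 : ∀ j, T j n = 0 := by
      rw [Real.sqrt_eq_zero (by positivity),
        add_eq_zero_iff_of_nonneg (by positivity) (by positivity)] at hV
      rw [Fin.forall_fin_two]
      simpa [(hlrv_pos 0).ne', (hlrv_pos 1).ne'] using hV
    simp [hT0, SeriesHAR.sampleMean]
  · rw [div_mul_div_comm, mul_comm _ √(lrv 0 / (T 0 n : ℝ) + lrv 1 / (T 1 n : ℝ)),
      mul_div_mul_left _ _ hV]
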